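/- Let $S$ be a Noetherian local ring with maximal ideal $\mathfrak m_S$ and residue field $K=S/\mathfrak m_S$, let $R$ be a Noetherian local ring that is a flat $S$-algebra, and assume that the special fibre $P=K\otimes_S R=R/\mathfrak m_S R$ is a regular local ring of dimension $n$. Let ${\bf F}=(F_1,\dots,F_n)$ be a sequence of elements of $R$, put $J_S=(F_1,\dots,F_n)\subset R$ and $H_0({\bf F})=R/J_S$, and let $f_i=F_i \bmod \mathfrak m_S R\in P$ and $J=(f_1,\dots,f_n)\subset P$. Suppose that ${\bf F}$ is a relative almost complete intersection over $S$, that is, $V(J)\subset \operatorname{Spec}(P)$ has codimension $n-1$, and $H_0({\bf F})$ is flat over $S$. Then: 1. $\operatorname{Ext}^n_R(H_0({\bf F}),R)$ is flat over $S$. It is a free $S$-module of finite rank whenever $R$ is a Weierstrass algebra over $S$, that is, whenever the residue field of $R$ is finite over $K$ and every quotient ring $R/\mathfrak a$ for which $R/(\mathfrak a+\mathfrak m_S R)$ is finite over $S$ is itself a finite $S$-module. (For example, if $S$ is complete, this holds as soon as the residue field of $R$ is finite over $K$.) 2. $\operatorname{Ext}^k_R(H_0({\bf F}),R)=0$ for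 all $k\ge n+1$. 3. $I/J$ deforms flatly: if $I=\bigcup_k (J:\mathfrak m_P^k)$ is the saturation of $J$ with respect to the maximal ideal $\mathfrak m_P$ of $P$, then there is an isomorphism of $R$-modules $K\otimes_S \operatorname{Ext}^n_R(H_0({\bf F}),R)\cong I/J$. -/

import Mathlib

open CategoryTheory IsLocalRing

universe u v

/-- The extension `𝔪_S R` to an `S`-algebra `R` of the maximal ideal of a local ring `S`. -/
abbrev maxExt (S : Type v) [CommRing S] [IsLocalRing S] (R : Type u) [CommRing R] [Algebra S R] :
    Ideal R :=
  (maximalIdeal S).map (algebraMap S R)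

/-- The special fibre `P = K ⊗_S R = R / 𝔪_S R`, where `K = S / 𝔪_S`. -/
abbrev SpecialFibre (S : Type v) [CommRing S] [IsLocalRing S] (R : Type u) [CommRing R]
    [Algebra S R] : Type u :=
  R ⧸ maxExt S R

/-- The ideal `(f_1, …, f_n)`. -/
abbrev seqIdeal {A : Type u} [CommRing A] {n : ℕ} (f : Fin n → A) : Ideal A :=
  Ideal.span (Set.range f)

/-- The Koszul homology module `H_0(f) = A / (f_1, …, f_n)`. -/
abbrev H0 {A : Type u} [CommRing A] {n : ℕ} (f : Fin n → A) : Type u :=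
  A ⧸ seqIdeal f

/-- `f_1, …, f_n` defines an almost complete intersection: the closed set `V(f_1, …, f_n)` has
codimension `n - 1`. (The unit ideal has height `⊤`, so it is excluded.) -/
def IsAlmostCompleteIntersection {A : Type u} [CommRing A] {n : ℕ} (f : Fin n → A) : Prop :=
  (seqIdeal f).height + 1 = n

/-- The reduction `f_i = F_i mod 𝔪_S` of a sequence in `R`, a sequence in the special fibre. -/
def reduction (S : Type v) [CommRing S] [IsLocalRing S] {R : Type u} [CommRing R] [Algebra S R]
    {n : ℕ} (F : Fin n → R) : Fin n → SpecialFibre S R :=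
  fun i => Ideal.Quotient.mk (maxExt S R) (F i)

/-- `F_1, …, F_n ∈ R` is a relative almost complete intersection over `S`: its reduction is an
almost complete intersection in the special fibre, and `H_0(F)` is flat over `S`. -/
structure IsRelativeAlmostCompleteIntersection (S : Type v) [CommRing S] [IsLocalRing S]
    {R : Type u} [CommRing R] [Algebra S R] {n : ℕ} (F : Fin n → R) : Prop where
  reduction_isACI : IsAlmostCompleteIntersection (reduction S F)
  flat_H0 : Module.Flat S (H0 F)

/-- The saturation `⋃_k (J : 𝔪^k)` of an ideal `J` of a local ring (the union of a chain, hence a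
supremum of ideals). -/
def saturation {A : Type u} [CommRing A] [IsLocalRing A] (J : Ideal A) : Ideal A :=
  ⨆ k : ℕ, J.colon ((maximalIdeal A ^ k : Ideal A) : Set A)

/-- The module `I / J`, where `I` is the saturation of `J`. -/
abbrev SaturationQuotient {A : Type u} [CommRing A] [IsLocalRing A] (J : Ideal A) : Type u :=
  saturation J ⧸ Submodule.submoduleOf J (saturation J)

/-- The local `S`-algebra `R` is of the kind for which the Weierstrass finiteness theorem holds:
its residue field is finite over that of `S`, and every quotient `R / 𝔞` whose special fibre
`R / (𝔞 + 𝔪_S R)` is finite over `S` (equivalently, over `S / 𝔪_S`) is itself finite over `S`. -/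
structure IsWeierstrassAlgebra (S : Type v) [CommRing S] [IsLocalRing S] (R : Type u) [CommRing R]
    [IsLocalRing R] [Algebra S R] : Prop where
  finite_residueField : Module.Finite S (ResidueField R)
  finite_quotient : ∀ 𝔞 : Ideal R,
    Module.Finite S (R ⧸ (𝔞 ⊔ maxExt S R)) → Module.Finite S (R ⧸ 𝔞)

theorem isPrecomplete_pi {A : Type v} [CommRing A] (I : Ideal A) [IsPrecomplete I A] (m : ℕ) :
    IsPrecomplete I (Fin m → A) := by
  refine ⟨fun f hf => ?_⟩
  have hc : ∀ i : Fin m, ∃ L : A, ∀ n, f n i ≡ L [SMOD (I ^ n • ⊤ : Submodule A A)] := by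
    intro i
    refine IsPrecomplete.prec ‹_› (f := fun n => f n i) fun {a b} hab => ?_
    have h := hf hab
    rw [SModEq.sub_mem] at h ⊢
    have h2 := Submodule.mem_map_of_mem (f := LinearMap.proj (R := A) (φ := fun _ => A) i) h
    rw [Submodule.map_smul''] at h2
    exact (Submodule.smul_mono le_rfl le_top) h2
  choose L hL using hc
  refine ⟨L, fun n => ?_⟩
  rw [SModEq.sub_mem, pi_eq_sum_univ' (f n - L)]
  refine Submodule.sum_mem _ fun i _ => Submodule.smul_mem_smul ?_ trivial
  have h := hL i n
  rw [SModEq.sub_mem] at h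
  simpa using h

/-- Over a complete base every Noetherian local algebra `R` with `𝔪_S R ≠ R` and finite residue
field extension, for instance `S⟦x_1, …, x_n⟧`, is a Weierstrass algebra. -/
theorem IsWeierstrassAlgebra.of_isAdicComplete (S : Type v) [CommRing S] [IsLocalRing S]
    [IsAdicComplete (maximalIdeal S) S] (R : Type u) [CommRing R] [IsLocalRing R]
    [IsNoetherianRing R] [Algebra S R] (hne : maxExt S R ≠ ⊤)
    (hres : Module.Finite S (ResidueField R)) : IsWeierstrassAlgebra S R := by
  refine ⟨hres, fun 𝔞 hfin => ?_⟩
  have hH : IsHausdorff (maxExt S R) (R ⧸ 𝔞) := .of_isLocalRing _ _ hne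
  have hH' : IsHausdorff (maximalIdeal S) (R ⧸ 𝔞) := IsHausdorff.map_algebraMap_iff.mp hH
  obtain ⟨m, g, hg⟩ := Module.Finite.exists_fin' S (R ⧸ (𝔞 ⊔ maxExt S R))
  choose y hy using fun i : Fin m =>
    Ideal.Quotient.factor_surjective (le_sup_left : 𝔞 ≤ 𝔞 ⊔ maxExt S R) (g (Pi.single i 1))
  let f : (Fin m → S) →ₗ[S] (R ⧸ 𝔞) := Fintype.linearCombination S y
  have := isPrecomplete_pi (maximalIdeal S) m
  refine Module.Finite.of_surjective f
    (surjective_of_mkQ_comp_surjective (I := maximalIdeal S) fun z => ?_)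
  obtain ⟨z, rfl⟩ := Submodule.mkQ_surjective _ z
  obtain ⟨r, rfl⟩ := Ideal.Quotient.mk_surjective z
  obtain ⟨c, hc⟩ := hg (Ideal.Quotient.mk _ r)
  have hfg : ∀ c : Fin m → S,
      Ideal.Quotient.factor (le_sup_left : 𝔞 ≤ 𝔞 ⊔ maxExt S R) (f c) = g c := by
    intro c
    have : (Ideal.Quotient.factorₐ S
        (le_sup_left : 𝔞 ≤ 𝔞 ⊔ maxExt S R)).toLinearMap ∘ₗ f = g := by
      refine LinearMap.pi_ext' fun i => LinearMap.ext_ring ?_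
      simpa [f, Fintype.linearCombination_apply_single] using hy i
    exact LinearMap.congr_fun this c
  refine ⟨c, ?_⟩
  simp only [LinearMap.comp_apply]
  rw [← sub_eq_zero, ← map_sub, Submodule.mkQ_apply, Submodule.Quotient.mk_eq_zero,
    Ideal.smul_top_eq_map, Submodule.restrictScalars_mem]
  obtain ⟨s, hs⟩ := Ideal.Quotient.mk_surjective (f c)
  have h1 := hfg c
  rw [hc, ← hs, Ideal.Quotient.factor_mk, Ideal.Quotient.eq] at h1
  rw [← hs, ← map_sub]
  have h2 := Ideal.mem_map_of_mem (Ideal.Quotient.mk 𝔞) h1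
  rw [Ideal.map_sup, Ideal.map_quotient_self, bot_sup_eq, Ideal.map_map] at h2
  exact h2

/-- The module `Ext^k_R(M, R)`. -/
abbrev ExtToRing (R : Type u) [CommRing R] (M : Type u) [AddCommGroup M] [Module R M] (k : ℕ) :
    Type u :=
  Abelian.Ext.{u} (ModuleCat.of R M) (ModuleCat.of R R) k

/-!
Write `J` for the ideal of `R` generated by the sequence, `M = R / J`, `P` for the special fibre
and `n = d + 1`.

*A regular sequence among the generators.* The image of `J` in the regular local ring `P` has
height `d`. Since regular local rings are Cohen-Macaulay (in the form
`IsRegularLocalRing.ext_quotient_prime_eq_zero`), prime avoidance replaces the generators of `J`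
by `rs, h` with `rs` of length `d` and regular on `P`
(`IsRegularLocalRing.exists_isWeaklyRegular_map_of_le_height`). By flatness of `R`, the sequence
`rs` is then regular on `R / 𝔞R` for every ideal `𝔞` of `S`
(`Module.Flat.isWeaklyRegular_quotient`).

*Vanishing.* As `M` is flat over `S`, its projective dimension over `R` is at most that of `M /
𝔪_S M` over `P` (`hasProjectiveDimensionLE_of_flat`), hence at most `n`, as `P` has global
dimension `n` (`IsRegularLocalRing.hasProjectiveDimensionLE`). So `Extᵏ(M, -) = 0` for `k > n`,
and `Extⁿ(M, -)` is right exact.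

*Flatness.* Flatness of `M` means that a relation `y h ∈ (rs) + 𝔞R` is congruent modulo `𝔞R` to a
relation in `(rs)` (`Module.Flat.exists_mul_sub_mem_ofList`). Under Rees' isomorphism `Extᵈ(M, Y)
≃ Hom(M, Y / (rs)Y)` this says that `Extᵈ(M, R) → Extᵈ(M, R / 𝔞R)` is surjective
(`ModuleCat.extMap_mkQ_surjective_of_flat`), so that `Extⁿ(M, 𝔞R) → Extⁿ(M, R)` is injective.
Together with right exactness this gives the equational criterion for `Extⁿ(M, R)`
(`ModuleCat.flat_ext_of_injective`).

*The special fibre.* By right exactness `Extⁿ(M, R) / 𝔪_S Extⁿ(M, R) ≃ Extⁿ(M, P)`. The exact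
sequence `0 → R / ((rs) : h) → R / (rs) → M → 0` and Rees' isomorphism compute the right-hand side
as the double colon `((rs) : ((rs) : h))` in `P` modulo the image of `J`
(`exists_doubleColon_linearMap_ext`). This double colon is the saturation of the image of `J`
(`IsRegularLocalRing.mem_doubleColon_iff_mem_saturation`): over `P`, the corresponding `Extⁿ` has
finite length because `Extⁿ⁺¹` vanishes, and `P / (rs)` has positive depth.

*Finiteness.* The quotient of the saturation by the image of `J` is killed by a power of the
maximal ideal. Over a Weierstrass algebra this makes `Extⁿ(M, R)` finite over `S`, hence free,
being flat.
-/

/-! ### Regular local rings -/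

/-- Exchange in a minimal system of generators: an element of `𝔪` outside `𝔪²` can replace one of
the generators. -/
theorem IsLocalRing.exists_finset_card_and_span_insert_eq_maximalIdeal {A : Type u} [CommRing A]
    [IsLocalRing A] [IsNoetherianRing A] {n : ℕ} (hn : (maximalIdeal A).spanFinrank = n + 1)
    {x : A} (hx : x ∈ maximalIdeal A) (hx2 : x ∉ maximalIdeal A ^ 2) :
    ∃ t : Finset A, t.card = n ∧ Ideal.span (insert x (t : Set A)) = maximalIdeal A := by
  classical
  have fg := (maximalIdeal A).fg_of_isNoetherianRing
  have fin := Submodule.FG.finite_generators fg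
  obtain ⟨s, hs⟩ := fin.exists_finset_coe
  have hspan : Ideal.span (s : Set A) = maximalIdeal A := by
    rw [hs]; exact Submodule.span_generators _
  have hcard : s.card = n + 1 := by
    rw [← hn, ← Submodule.FG.generators_ncard fg, ← hs, Set.ncard_coe_finset]
  have hxs : x ∈ Submodule.span A (s : Set A) := by
    have := hspan ▸ hx
    exact this
  obtain ⟨c, -, hc⟩ := Submodule.mem_span_finset.mp hxs
  have hsm : ∀ y ∈ s, y ∈ maximalIdeal A := fun y hy => hspan ▸ Ideal.subset_span hy
  obtain ⟨y, hy, hyu⟩ : ∃ y ∈ s, IsUnit (c y) := by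
    by_contra! h
    refine hx2 ?_
    rw [← hc, pow_two]
    exact Submodule.sum_mem _ fun y hy => Ideal.mul_mem_mul ((mem_maximalIdeal _).mpr (h y hy))
      (hsm y hy)
  refine ⟨s.erase y, by rw [Finset.card_erase_of_mem hy, hcard]; rfl, le_antisymm ?_ ?_⟩
  · rw [Ideal.span_le]
    rintro z (rfl | hz)
    · exact hx
    · exact hsm z (Finset.mem_of_mem_erase hz)
  · rw [← hspan, Ideal.span_le]
    intro z hz
    by_cases hzy : z = y
    · subst hzy
      rw [← Finset.add_sum_erase s _ hz] at hc
      have : c z * z ∈ Ideal.span (insert x (s.erase z : Set A)) := by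
        rw [show c z * z = x - ∑ a ∈ s.erase z, c a • a by rw [← hc]; simp]
        refine Submodule.sub_mem _ (Ideal.subset_span (Set.mem_insert _ _))
          (Submodule.sum_mem _ fun a ha => Ideal.mul_mem_left _ _ (Ideal.subset_span ?_))
        exact Set.mem_insert_of_mem _ (Finset.mem_coe.mpr ha)
      exact (Ideal.unit_mul_mem_iff_mem _ hyu).mp this
    · exact Ideal.subset_span (Set.mem_insert_of_mem _ (by simpa [hzy] using hz))

theorem IsRegularLocalRing.quotient_span_singleton {A : Type u} [CommRing A]
    [IsRegularLocalRing A] {n : ℕ} (hn : ringKrullDim A = (n + 1 : ℕ)) {x : A}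
    (hx : x ∈ maximalIdeal A) (hx2 : x ∉ maximalIdeal A ^ 2) :
    IsRegularLocalRing (A ⧸ Ideal.span {x}) ∧ ringKrullDim (A ⧸ Ideal.span {x}) = n := by
  classical
  have hreg := (isRegularLocalRing_iff A).mp ‹_›
  rw [hn] at hreg
  have hreg' : (maximalIdeal A).spanFinrank = n + 1 := by exact_mod_cast hreg
  obtain ⟨t, htc, ht⟩ :=
    exists_finset_card_and_span_insert_eq_maximalIdeal hreg' hx hx2
  have hne : Ideal.span {x} ≠ ⊤ := fun h => (maximalIdeal.isMaximal A).ne_top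
    (top_le_iff.mp (h ▸ (Ideal.span_singleton_le_iff_mem _).mpr hx))
  have : Nontrivial (A ⧸ Ideal.span {x}) := Ideal.Quotient.nontrivial_iff.mpr hne
  have : IsLocalRing (A ⧸ Ideal.span {x}) :=
    .of_surjective' (Ideal.Quotient.mk _) Ideal.Quotient.mk_surjective
  have hgen : Ideal.span ((Ideal.Quotient.mk (Ideal.span {x})) '' (t : Set A)) =
      maximalIdeal (A ⧸ Ideal.span {x}) := by
    have h1 : (maximalIdeal A).map (Ideal.Quotient.mk (Ideal.span {x})) =
        maximalIdeal (A ⧸ Ideal.span {x}) := by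
      refine IsLocalRing.eq_maximalIdeal (Ideal.map_eq_top_or_isMaximal_of_surjective _
        Ideal.Quotient.mk_surjective (maximalIdeal.isMaximal A) |>.resolve_left fun h => ?_)
      have h2 := congrArg (Ideal.comap (Ideal.Quotient.mk (Ideal.span {x}))) h
      rw [Ideal.comap_map_of_surjective _ Ideal.Quotient.mk_surjective, Ideal.comap_top] at h2
      refine (maximalIdeal.isMaximal A).ne_top (top_le_iff.mp (h2 ▸ sup_le le_rfl ?_))
      rw [← RingHom.ker_eq_comap_bot, Ideal.mk_ker]
      exact (Ideal.span_singleton_le_iff_mem _).mpr hx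
    rw [← h1, ← ht, Ideal.span_insert, Ideal.map_sup, Ideal.map_quotient_self, bot_sup_eq,
      Ideal.map_span]
  have hle : (maximalIdeal (A ⧸ Ideal.span {x})).spanFinrank ≤ n := by
    rw [← hgen, ← htc]
    refine (Submodule.spanFinrank_span_le_ncard_of_finite (t.finite_toSet.image _)).trans ?_
    exact (Set.ncard_image_le t.finite_toSet).trans (by rw [Set.ncard_coe_finset])
  have hge : ((n : ℕ) : WithBot ℕ∞) ≤ ringKrullDim (A ⧸ Ideal.span {x}) := by
    have h := ringKrullDim_le_ringKrullDim_quotSMulTop_succ hx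
    rw [hn, ← Submodule.ideal_span_singleton_smul, Ideal.smul_eq_mul, Ideal.mul_top] at h
    push_cast at h
    exact ENat.WithBot.add_le_add_one_right_iff.mp (by exact_mod_cast h)
  refine ⟨.of_spanFinrank_maximalIdeal_le _ (le_trans (by exact_mod_cast hle) hge),
    le_antisymm ((ringKrullDim_le_spanFinrank_maximalIdeal _).trans (by exact_mod_cast hle)) hge⟩

/-- Prime avoidance; one of the ideals avoided, `𝔪²`, need not be prime. -/
theorem IsRegularLocalRing.exists_mem_maximalIdeal_notMem_sq {A : Type u} [CommRing A]
    [IsRegularLocalRing A] {n : ℕ} (hn : ringKrullDim A = (n + 1 : ℕ)) :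
    ∃ x ∈ maximalIdeal A, x ∉ maximalIdeal A ^ 2 ∧ ∀ p ∈ minimalPrimes A, x ∉ p := by
  classical
  by_contra! h
  have hfin := minimalPrimes.finite_of_isNoetherianRing A
  have hsub : ((maximalIdeal A : Ideal A) : Set A) ⊆
      ⋃ i ∈ (↑(insert (maximalIdeal A ^ 2) hfin.toFinset) : Set (Ideal A)), (id i : Ideal A) := by
    intro x hx
    by_cases hx2 : x ∈ maximalIdeal A ^ 2
    · exact Set.mem_biUnion (by simp) hx2
    · obtain ⟨p, hp, hxp⟩ := h x hx hx2
      exact Set.mem_biUnion (x := p) (by simp [hp]) hxp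
  rw [Ideal.subset_union_prime (maximalIdeal A ^ 2) (maximalIdeal A ^ 2)] at hsub
  · obtain ⟨i, hi, hle⟩ := hsub
    rw [Finset.mem_insert, Set.Finite.mem_toFinset] at hi
    have hzero : (maximalIdeal A).height = 0 → False := fun h0 => by
      have := maximalIdeal_height_eq_ringKrullDim (R := A)
      rw [h0, hn] at this
      exact absurd this (by norm_cast)
    rcases hi with rfl | hi
    · have h0 : maximalIdeal A = ⊥ := Submodule.eq_bot_of_le_smul_of_le_jacobson_bot
        (maximalIdeal A) _ (maximalIdeal A).fg_of_isNoetherianRing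
        (by simpa [pow_two] using hle) (maximalIdeal_le_jacobson _)
      have : IsField A := (isField_iff_maximalIdeal_eq).mpr h0
      have h1 := ringKrullDim_eq_zero_of_isField this
      rw [hn] at h1
      exact absurd h1 (by norm_cast)
    · have hip : i.IsPrime := hi.1.1
      have : i = maximalIdeal A := le_antisymm (le_maximalIdeal hip.ne_top) hle
      subst this
      exact hzero (Ideal.height_eq_zero_iff.mpr hi)
  · intro i hi h1 _
    simp only [Finset.mem_insert, h1, false_or, Set.Finite.mem_toFinset] at hi
    exact hi.1.1

/-- By induction on the dimension, `(x)` is a prime ideal for some `x ∈ 𝔪` avoiding the minimal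
primes; the minimal prime `𝔭` below it satisfies `𝔭 = x𝔭`, hence vanishes. -/
theorem IsRegularLocalRing.isDomain (n : ℕ) : ∀ (A : Type u) [CommRing A]
    [IsRegularLocalRing A], ringKrullDim A = n → IsDomain A := by
  induction n with
  | zero =>
    intro A _ _ hn
    have hreg := (isRegularLocalRing_iff A).mp ‹_›
    rw [hn] at hreg
    have h0 : (maximalIdeal A).spanFinrank = 0 := by exact_mod_cast hreg
    rw [Submodule.spanFinrank_eq_zero_iff_eq_bot (maximalIdeal A).fg_of_isNoetherianRing] at h0
    exact ((isField_iff_maximalIdeal_eq).mpr h0).isDomain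
  | succ n ih =>
    intro A _ _ hn
    obtain ⟨x, hx, hx2, hmin⟩ := exists_mem_maximalIdeal_notMem_sq hn
    obtain ⟨hreg, hdim⟩ := quotient_span_singleton hn hx hx2
    have hdom := ih _ hdim
    have hprime : (Ideal.span {x}).IsPrime := (Ideal.Quotient.isDomain_iff_prime _).mp hdom
    obtain ⟨p, hp, hpx⟩ := Ideal.exists_minimalPrimes_le (bot_le : ⊥ ≤ Ideal.span {x})
    have hpp : p.IsPrime := hp.1.1
    have hpbot : p = ⊥ := by
      refine Submodule.eq_bot_of_le_smul_of_le_jacobson_bot (Ideal.span {x}) _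
        p.fg_of_isNoetherianRing (fun y hy => ?_) (((Ideal.span_singleton_le_iff_mem _).mpr
          hx).trans (maximalIdeal_le_jacobson _))
      obtain ⟨z, rfl⟩ := Ideal.mem_span_singleton'.mp (hpx hy)
      have hz : z ∈ p := (hpp.mem_or_mem hy).resolve_right (hmin p hp)
      rw [mul_comm, smul_eq_mul]
      exact Ideal.mul_mem_mul (Ideal.mem_span_singleton_self x) hz
    subst hpbot
    exact IsDomain.of_bot_isPrime A

/-! ### Projective dimension over regular local rings and over quotients -/

/-- The condition `hN` on presentations says that `Tor₁(A ⧸ 𝔟, N) = 0`. Lifting a basis of `N ⧸ 𝔟N`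
to `N` gives an isomorphism by Nakayama's lemma, applied to cokernel and kernel. -/
theorem Module.projective_of_projective_quotient {A : Type u} [CommRing A] [IsLocalRing A]
    [IsNoetherianRing A] {𝔟 : Ideal A} (h𝔟 : 𝔟 ≤ maximalIdeal A) {N : Type u} [AddCommGroup N]
    [Module A N] [Module.Finite A N]
    (hN : ∀ (m : ℕ) (f : (Fin m → A) →ₗ[A] N), Function.Surjective f → ∀ y ∈ LinearMap.ker f,
      y ∈ (𝔟 • ⊤ : Submodule A (Fin m → A)) → y ∈ 𝔟 • LinearMap.ker f)
    [Module.Projective (A ⧸ 𝔟) (N ⧸ (𝔟 • ⊤ : Submodule A N))] : Module.Projective A N := by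
  have hne : 𝔟 ≠ ⊤ := fun h => (maximalIdeal.isMaximal A).ne_top (top_le_iff.mp (h ▸ h𝔟))
  have hjac : 𝔟 ≤ Ideal.jacobson ⊥ := h𝔟.trans (maximalIdeal_le_jacobson _)
  have : Nontrivial (A ⧸ 𝔟) := Ideal.Quotient.nontrivial_iff.mpr hne
  have : IsLocalRing (A ⧸ 𝔟) :=
    .of_surjective' (Ideal.Quotient.mk _) Ideal.Quotient.mk_surjective
  have : Module.Finite (A ⧸ 𝔟) (N ⧸ (𝔟 • ⊤ : Submodule A N)) :=
    .of_restrictScalars_finite A _ _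
  have : Module.Free (A ⧸ 𝔟) (N ⧸ (𝔟 • ⊤ : Submodule A N)) := Module.free_of_flat_of_isLocalRing
  let b := Module.finBasis (A ⧸ 𝔟) (N ⧸ (𝔟 • ⊤ : Submodule A N))
  choose y hy using fun i => Submodule.mkQ_surjective (𝔟 • ⊤ : Submodule A N) (b i)
  let f := Fintype.linearCombination A y
  have hfb : ∀ c, Submodule.mkQ (𝔟 • ⊤ : Submodule A N) (f c) =
      ∑ i, Ideal.Quotient.mk 𝔟 (c i) • b i := by
    intro c
    simp only [f, Fintype.linearCombination_apply, map_sum, map_smul, hy]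
    rfl
  have hsurj : Function.Surjective f := by
    rw [← LinearMap.range_eq_top, ← top_le_iff]
    refine Submodule.le_of_le_smul_of_le_jacobson_bot Module.Finite.fg_top hjac fun z _ => ?_
    choose c hc using fun i => Ideal.Quotient.mk_surjective (b.repr (Submodule.mkQ _ z) i)
    have hz : Submodule.mkQ (𝔟 • ⊤ : Submodule A N) (z - f c) = 0 := by
      rw [map_sub, hfb]
      simp only [hc]
      rw [b.sum_repr, sub_self]
    rw [Submodule.mkQ_apply, Submodule.Quotient.mk_eq_zero] at hz
    rw [← add_sub_cancel (f c) z]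
    exact Submodule.add_mem_sup ⟨c, rfl⟩ hz
  have hker : LinearMap.ker f = ⊥ := by
    refine Submodule.eq_bot_of_le_smul_of_le_jacobson_bot 𝔟 _ (IsNoetherian.noetherian _)
      (fun c hc => hN _ f hsurj c hc ?_) hjac
    have h0 := hfb c
    rw [LinearMap.mem_ker.mp hc, map_zero] at h0
    have hc0 : ∀ i, c i ∈ 𝔟 := fun i => Ideal.Quotient.eq_zero_iff_mem.mp
      (Fintype.linearIndependent_iff.mp b.linearIndependent _ h0.symm i)
    rw [pi_eq_sum_univ' c]
    exact Submodule.sum_mem _ fun i _ => Submodule.smul_mem_smul (hc0 i) trivial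
  exact Module.Projective.of_equiv
    (LinearEquiv.ofBijective f ⟨LinearMap.ker_eq_bot.mp hker, hsurj⟩)

/-- Descent of projective dimension along `A → A ⧸ 𝔟`. The predicate `C` singles out modules for
which reduction modulo `𝔟` keeps free presentations exact (so that `Tor₁(A ⧸ 𝔟, N) = 0`) and which
is inherited by syzygies; a resolution of `N ⧸ 𝔟N` then lifts to one of `N`. -/
theorem hasProjectiveDimensionLE_of_quotient {A : Type u} [CommRing A] [IsLocalRing A]
    [IsNoetherianRing A] {𝔟 : Ideal A} (h𝔟 : 𝔟 ≤ maximalIdeal A)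
    (C : ∀ (N : Type u) [AddCommGroup N] [Module A N], Prop)
    (hC : ∀ (N : Type u) [AddCommGroup N] [Module A N], C N →
      ∀ (m : ℕ) (f : (Fin m → A) →ₗ[A] N), Function.Surjective f → C (LinearMap.ker f) ∧
        ∀ y ∈ LinearMap.ker f, y ∈ (𝔟 • ⊤ : Submodule A (Fin m → A)) → y ∈ 𝔟 • LinearMap.ker f)
    (n : ℕ) : ∀ (N : Type u) [AddCommGroup N] [Module A N] [Module.Finite A N], C N →
      HasProjectiveDimensionLE (ModuleCat.of (A ⧸ 𝔟) (N ⧸ (𝔟 • ⊤ : Submodule A N))) n →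
      HasProjectiveDimensionLE (ModuleCat.of A N) n := by
  induction n with
  | zero =>
    intro N _ _ _ hN hpd
    rw [← projective_iff_hasProjectiveDimensionLE_zero, ← IsProjective.iff_projective] at hpd ⊢
    exact Module.projective_of_projective_quotient h𝔟 fun m f hf => (hC N hN m f hf).2
  | succ n ih =>
    intro N _ _ _ hN hpd
    obtain ⟨m, f, hf⟩ := Module.Finite.exists_fin' A N
    obtain ⟨hCk, hk⟩ := hC N hN m f hf
    have hq : Function.Surjective (algebraMap A (A ⧸ 𝔟)) := Ideal.Quotient.mk_surjective
    let α : (LinearMap.ker f ⧸ (𝔟 • ⊤ : Submodule A (LinearMap.ker f))) →ₗ[A]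
        ((Fin m → A) ⧸ (𝔟 • ⊤ : Submodule A (Fin m → A))) :=
      Submodule.mapQ _ _ (LinearMap.ker f).subtype (Submodule.smul_top_le_comap_smul_top _ _)
    let β : ((Fin m → A) ⧸ (𝔟 • ⊤ : Submodule A (Fin m → A))) →ₗ[A]
        (N ⧸ (𝔟 • ⊤ : Submodule A N)) :=
      Submodule.mapQ _ _ f (Submodule.smul_top_le_comap_smul_top _ _)
    have hα : Function.Injective α := by
      rw [injective_iff_map_eq_zero]
      intro z hz
      obtain ⟨z, rfl⟩ := Submodule.mkQ_surjective _ z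
      rw [Submodule.mkQ_apply, Submodule.mapQ_apply, Submodule.Quotient.mk_eq_zero] at hz
      have h1 := hk z.1 z.2 hz
      have h2 : (𝔟 • ⊤ : Submodule A (LinearMap.ker f)).map (LinearMap.ker f).subtype =
          𝔟 • LinearMap.ker f := by
        rw [Submodule.map_smul'', Submodule.map_top, Submodule.range_subtype]
      rw [← h2] at h1
      obtain ⟨w, hw, hwz⟩ := h1
      rw [Submodule.mkQ_apply, Submodule.Quotient.mk_eq_zero]
      rwa [Subtype.ext hwz] at hw
    have hβ : Function.Surjective β := by
      intro z
      obtain ⟨z, rfl⟩ := Submodule.mkQ_surjective _ z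
      obtain ⟨w, rfl⟩ := hf z
      exact ⟨Submodule.mkQ _ w, rfl⟩
    have hex : Function.Exact α β := by
      intro z
      constructor
      · obtain ⟨z, rfl⟩ := Submodule.mkQ_surjective _ z
        intro hz
        rw [Submodule.mkQ_apply, Submodule.mapQ_apply, Submodule.Quotient.mk_eq_zero] at hz
        have h2 : (𝔟 • ⊤ : Submodule A (Fin m → A)).map f = 𝔟 • ⊤ := by
          rw [Submodule.map_smul'', Submodule.map_top, LinearMap.range_eq_top.mpr hf]
        rw [← h2] at hz
        obtain ⟨w, hw, hwz⟩ := hz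
        refine ⟨Submodule.mkQ _ ⟨z - w, by simp [hwz]⟩, ?_⟩
        simp only [α, Submodule.mkQ_apply, Submodule.mapQ_apply, Submodule.subtype_apply]
        rw [Submodule.Quotient.eq]
        simpa using Submodule.neg_mem _ hw
      · rintro ⟨w, rfl⟩
        obtain ⟨w, rfl⟩ := Submodule.mkQ_surjective _ w
        simp [α, β]
    let T : ShortComplex (ModuleCat.{u} (A ⧸ 𝔟)) := ModuleCat.shortComplexOfCompEqZero
      (α.extendScalarsOfSurjective hq) (β.extendScalarsOfSurjective hq)
      (LinearMap.ext fun z => hex.apply_apply_eq_zero z)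
    have hT : T.ShortExact := ModuleCat.shortComplex_shortExact T hex hα hβ
    have hX : HasProjectiveDimensionLE (ModuleCat.of (A ⧸ 𝔟)
        (LinearMap.ker f ⧸ (𝔟 • ⊤ : Submodule A (LinearMap.ker f)))) n := by
      have hfree : Module.Projective (A ⧸ 𝔟)
          ((Fin m → A) ⧸ (𝔟 • ⊤ : Submodule A (Fin m → A))) :=
        Module.Projective.of_equiv ((TensorProduct.quotTensorEquivQuotSMul (Fin m → A)
          𝔟).extendScalarsOfSurjective hq)
      have hp : Projective T.X₂ := (IsProjective.iff_projective _).mp hfree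
      exact (hT.hasProjectiveDimensionLT_X₃_iff n hp).mp hpd
    have h3 := ih (LinearMap.ker f) hCk hX
    have hp : Projective f.shortComplexKer.X₂ := (IsProjective.iff_projective _).mp
      (inferInstanceAs (Module.Projective A (Fin m → A)))
    exact ((LinearMap.shortExact_shortComplexKer hf).hasProjectiveDimensionLT_X₃_iff n hp).mpr h3

/-- The global dimension of a regular local ring: the first syzygy of `N` is torsion-free, so its
projective dimension can be computed modulo `x ∈ 𝔪 \ 𝔪²`, that is, over a regular local ring of
dimension one less. -/
theorem IsRegularLocalRing.hasProjectiveDimensionLE (n : ℕ) : ∀ (A : Type u) [CommRing A]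
    [IsRegularLocalRing A], ringKrullDim A = n → ∀ (N : Type u) [AddCommGroup N] [Module A N]
    [Module.Finite A N], HasProjectiveDimensionLE (ModuleCat.of A N) n := by
  induction n with
  | zero =>
    intro A _ _ hn N _ _ _
    have := isDomain 0 A hn
    have hreg := (isRegularLocalRing_iff A).mp ‹_›
    rw [hn] at hreg
    have h0 : (maximalIdeal A).spanFinrank = 0 := by exact_mod_cast hreg
    rw [Submodule.spanFinrank_eq_zero_iff_eq_bot (maximalIdeal A).fg_of_isNoetherianRing] at h0
    let _ := ((isField_iff_maximalIdeal_eq).mpr h0).toField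
    rw [← projective_iff_hasProjectiveDimensionLE_zero, ← IsProjective.iff_projective]
    exact Module.Projective.of_free
  | succ n ih =>
    intro A _ _ hn N _ _ _
    have := isDomain _ A hn
    obtain ⟨x, hx, hx2, -⟩ := exists_mem_maximalIdeal_notMem_sq hn
    obtain ⟨hreg, hdim⟩ := quotient_span_singleton hn hx hx2
    have hx0 : x ≠ 0 := fun h => hx2 (h ▸ Submodule.zero_mem _)
    obtain ⟨m, f, hf⟩ := Module.Finite.exists_fin' A N
    have hregx (m : ℕ) (y : Fin m → A) (h : x • y = 0) : y = 0 :=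
      (smul_eq_zero.mp h).resolve_left hx0
    have hp : Projective f.shortComplexKer.X₂ := (IsProjective.iff_projective _).mp
      (inferInstanceAs (Module.Projective A (Fin m → A)))
    refine ((LinearMap.shortExact_shortComplexKer hf).hasProjectiveDimensionLT_X₃_iff n hp).mpr ?_
    refine hasProjectiveDimensionLE_of_quotient (𝔟 := Ideal.span {x})
      ((Ideal.span_singleton_le_iff_mem _).mpr hx) (fun N _ _ => ∀ y : N, x • y = 0 → y = 0)
      (fun N _ _ hN m f _ => ⟨?_, ?_⟩) n (LinearMap.ker f) ?_ (ih _ hdim _)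
    · exact fun y hy => Subtype.ext (hregx m y.1 (congrArg Subtype.val hy))
    · intro y hy hyx
      rw [Submodule.ideal_span_singleton_smul] at hyx ⊢
      obtain ⟨z, -, rfl⟩ := hyx
      exact Submodule.smul_mem_pointwise_smul _ _ _ (hN _ (by simpa using hy))
    · exact fun y hy => Subtype.ext (hregx m y.1 (congrArg Subtype.val hy))

/-! ### Regular sequences on modules flat over a base -/

section FlatBase

variable {S : Type v} [CommRing S] {R : Type u} [CommRing R] [Algebra S R] {X : Type u}
  [AddCommGroup X] [Module R X] [Module S X] [IsScalarTower S R X]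

theorem Submodule.algebraMap_smul_mem_map_smul_top {𝔞 : Ideal S} {s : S} (hs : s ∈ 𝔞) (x : X) :
    s • x ∈ (Ideal.map (algebraMap S R) 𝔞 • ⊤ : Submodule R X) := by
  rw [← _root_.algebraMap_smul R s x]
  exact Submodule.smul_mem_smul (Ideal.mem_map_of_mem _ hs) Submodule.mem_top

theorem Submodule.exists_sum_of_mem_map_smul_top {𝔞 : Ideal S} {x : X}
    (hx : x ∈ (Ideal.map (algebraMap S R) 𝔞 • ⊤ : Submodule R X)) :
    ∃ (k : ℕ) (s : Fin k → S) (y : Fin k → X), (∀ i, s i ∈ 𝔞) ∧ x = ∑ i, s i • y i := by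
  have h : x ∈ (𝔞 • ⊤ : Submodule S X) := by
    have := Ideal.smul_restrictScalars 𝔞 (⊤ : Submodule R X)
    rw [Submodule.restrictScalars_top] at this
    rw [← this]
    exact hx
  refine Submodule.smul_induction_on h (fun a ha y _ => ?_) ?_
  · exact ⟨1, fun _ => a, fun _ => y, fun _ => ha, by simp⟩
  · rintro _ _ ⟨k, s, y, hs, rfl⟩ ⟨k', s', y', hs', rfl⟩
    refine ⟨k + k', Fin.append s s', Fin.append y y', fun i => ?_, ?_⟩
    · refine Fin.addCases (fun i => ?_) (fun i => ?_) i
      · simpa using hs i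
      · simpa using hs' i
    · rw [Fin.sum_univ_add]
      simp

/-- For a flat module `X`, the transporter of `𝔞 X` by `c` is `(𝔞 : c) X`. -/
theorem Module.Flat.mem_colon_smul_top [Module.Flat S X] {𝔞 : Ideal S} {c : S} {y : X}
    (h : c • y ∈ (Ideal.map (algebraMap S R) 𝔞 • ⊤ : Submodule R X)) :
    y ∈ (Ideal.map (algebraMap S R) (Submodule.colon 𝔞 {c}) • ⊤ : Submodule R X) := by
  obtain ⟨k, s, x, hs, hx⟩ := Submodule.exists_sum_of_mem_map_smul_top h
  have hrel : ∑ i, (Fin.cons c (fun i => -s i) : Fin (k + 1) → S) i •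
      (Fin.cons y x : Fin (k + 1) → X) i = 0 := by
    rw [Fin.sum_univ_succ]
    simp [hx]
  obtain ⟨l, a, u, hu, ha⟩ := Module.Flat.isTrivialRelation_of_sum_smul_eq_zero hrel
  have h0 := hu 0
  rw [Fin.cons_zero] at h0
  rw [h0]
  refine Submodule.sum_mem _ fun j _ => Submodule.algebraMap_smul_mem_map_smul_top ?_ _
  rw [Submodule.mem_colon_singleton]
  have h1 := ha j
  rw [Fin.sum_univ_succ] at h1
  simp only [Fin.cons_zero, Fin.cons_succ] at h1
  rw [smul_eq_mul, mul_comm, eq_neg_of_add_eq_zero_left h1]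
  exact Submodule.neg_mem _ (Submodule.sum_mem _ fun i _ =>
    Ideal.mul_mem_right _ _ (Submodule.neg_mem _ (hs i)))

open scoped Pointwise

/-- If `r` is regular on `X / 𝔞X` for every ideal `𝔞` of `S`, then `X / rX` is again flat, by the
equational criterion. -/
theorem Module.Flat.quotSMulTop [Module.Flat S X] {r : R}
    (hr : ∀ (𝔞 : Ideal S) (x : X), r • x ∈ (Ideal.map (algebraMap S R) 𝔞 • ⊤ : Submodule R X) →
      x ∈ (Ideal.map (algebraMap S R) 𝔞 • ⊤ : Submodule R X)) :
    Module.Flat S (QuotSMulTop r X) := by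
  refine Module.Flat.of_forall_isTrivialRelation fun {l f x} hfx => ?_
  choose y hy using fun i => Submodule.mkQ_surjective (r • ⊤ : Submodule R X) (x i)
  have h0 : (Submodule.mkQ (r • ⊤ : Submodule R X)) (∑ i, f i • y i) = 0 := by
    rw [← hfx, map_sum]
    refine Finset.sum_congr rfl fun i _ => ?_
    rw [← hy, ← algebraMap_smul R, map_smul, algebraMap_smul]
  rw [Submodule.mkQ_apply, Submodule.Quotient.mk_eq_zero] at h0
  obtain ⟨z, -, hz⟩ := h0
  have hz' : r • z = ∑ i, f i • y i := hz
  have h1 := hr (Ideal.span (Set.range f)) z (by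
    rw [hz']
    exact Submodule.sum_mem _ fun i _ =>
      Submodule.algebraMap_smul_mem_map_smul_top (Ideal.subset_span (Set.mem_range_self i)) _)
  rw [Ideal.map_span, ← Set.range_comp] at h1
  obtain ⟨w, hw⟩ : ∃ w : Fin l → X, z = ∑ i, f i • w i := by
    clear hz hz'
    refine Submodule.smul_induction_on h1 (fun a ha x _ => ?_) ?_
    · obtain ⟨c, rfl⟩ := (Ideal.mem_span_range_iff_exists_fun).mp ha
      refine ⟨fun i => c i • x, ?_⟩
      rw [Finset.sum_smul]
      refine Finset.sum_congr rfl fun i _ => ?_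
      rw [mul_comm, mul_smul, Function.comp_apply, algebraMap_smul]
    · rintro x y ⟨w, rfl⟩ ⟨w', rfl⟩
      exact ⟨w + w', by simp [Finset.sum_add_distrib]⟩
  have hrel : ∑ i, f i • (y i - r • w i) = 0 := by
    simp only [smul_sub, Finset.sum_sub_distrib]
    rw [← hz', hw, Finset.smul_sum, sub_eq_zero]
    exact Finset.sum_congr rfl fun i _ => smul_comm _ _ _
  obtain ⟨k, a, v, hv, ha⟩ := Module.Flat.isTrivialRelation_of_sum_smul_eq_zero hrel
  refine ⟨k, a, fun j => Submodule.mkQ _ (v j), fun i => ?_, ha⟩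
  have h3 : Submodule.mkQ (r • ⊤ : Submodule R X) (y i - r • w i) = x i := by
    rw [map_sub, hy, sub_eq_self, Submodule.mkQ_apply, Submodule.Quotient.mk_eq_zero]
    exact Submodule.smul_mem_pointwise_smul _ _ _ trivial
  rw [← h3]
  simp only [hv]
  rw [map_sum]
  refine Finset.sum_congr rfl fun j _ => ?_
  rw [← algebraMap_smul R, map_smul, algebraMap_smul]

variable [IsLocalRing S] [IsNoetherianRing S] [IsLocalRing R] [IsNoetherianRing R]

/-- An element `r` of `R` that is regular on the special fibre of a finite `R`-module flat over `S`
stays regular modulo every ideal of `S`. -/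
theorem Module.Flat.mem_smul_top_of_smul_mem [Module.Finite R X] [Module.Flat S X]
    (hloc : maxExt S R ≤ maximalIdeal R) {r : R}
    (hr : ∀ x : X, r • x ∈ (maxExt S R • ⊤ : Submodule R X) →
      x ∈ (maxExt S R • ⊤ : Submodule R X)) (𝔞 : Ideal S) :
    ∀ x : X, r • x ∈ (Ideal.map (algebraMap S R) 𝔞 • ⊤ : Submodule R X) →
      x ∈ (Ideal.map (algebraMap S R) 𝔞 • ⊤ : Submodule R X) := by
  -- Noetherian induction: the claim is assumed for all ideals strictly larger than `𝔞`.
  induction 𝔞 using IsNoetherian.induction with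
  | hgt 𝔞 ih =>
  by_cases htop : 𝔞 = ⊤
  · subst htop
    intro x _
    rw [Ideal.map_top, Submodule.top_smul]
    trivial
  by_cases hm : 𝔞 = maximalIdeal S
  · subst hm; exact hr
  have hlt : 𝔞 < maximalIdeal S := lt_of_le_of_ne (le_maximalIdeal htop) hm
  obtain ⟨c, hc, hca⟩ := SetLike.exists_of_lt hlt
  -- An element killed by `r` modulo `𝔞` is a multiple of `c` modulo `𝔞`, and the cofactor is
  -- killed by `r` modulo `(𝔞 : c)`.
  have key : ∀ x : X, r • x ∈ (Ideal.map (algebraMap S R) 𝔞 • ⊤ : Submodule R X) →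
      ∃ y : X, x - c • y ∈ (Ideal.map (algebraMap S R) 𝔞 • ⊤ : Submodule R X) ∧
        r • y ∈ (Ideal.map (algebraMap S R) (Submodule.colon 𝔞 {c}) • ⊤ : Submodule R X) := by
    intro x hx
    have h1 : x ∈ (Ideal.map (algebraMap S R) (𝔞 ⊔ Ideal.span {c}) • ⊤ : Submodule R X) := by
      refine ih _ (lt_of_le_of_ne le_sup_left fun h => hca ?_) x
        (Submodule.smul_mono_left (Ideal.map_mono le_sup_left) hx)
      rw [h]
      exact Ideal.mem_sup_right (Ideal.mem_span_singleton_self c)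
    rw [Ideal.map_sup, Submodule.sup_smul, Ideal.map_span, Set.image_singleton,
      Submodule.ideal_span_singleton_smul, Submodule.mem_sup] at h1
    obtain ⟨z, hz, w, hw, rfl⟩ := h1
    obtain ⟨y, -, rfl⟩ := hw
    have hy : (algebraMap S R c) • y = c • y := algebraMap_smul R c y
    refine ⟨y, ?_, Module.Flat.mem_colon_smul_top ?_⟩
    · simpa [hy] using hz
    · have h2 := Submodule.sub_mem _ hx (Submodule.smul_mem _ r hz)
      rw [← smul_sub, add_sub_cancel_left] at h2
      have h3 : r • (algebraMap S R c • y) ∈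
          (Ideal.map (algebraMap S R) 𝔞 • ⊤ : Submodule R X) := h2
      rwa [hy, smul_comm] at h3
  by_cases hcol : Submodule.colon 𝔞 {c} = 𝔞
  · -- Multiplication by `c` is surjective on the finite module of classes killed by `r`.
    let W : Submodule R X :=
      (Ideal.map (algebraMap S R) 𝔞 • ⊤ : Submodule R X).comap (LinearMap.lsmul R X r)
    have hW : W ≤ Ideal.map (algebraMap S R) 𝔞 • ⊤ := by
      refine Submodule.le_of_le_smul_of_le_jacobson_bot (I := maxExt S R)
        (IsNoetherian.noetherian W) (hloc.trans (maximalIdeal_le_jacobson _)) fun x hx => ?_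
      obtain ⟨y, hy, hry⟩ := key x hx
      rw [hcol] at hry
      rw [← sub_add_cancel x (c • y)]
      refine Submodule.add_mem_sup hy ?_
      rw [← _root_.algebraMap_smul R c y]
      exact Submodule.smul_mem_smul (Ideal.mem_map_of_mem _ hc) hry
    exact fun x hx => hW hx
  · intro x hx
    obtain ⟨y, hy, hry⟩ := key x hx
    have hle : 𝔞 ≤ Submodule.colon 𝔞 {c} := fun s hs => by
      rw [Submodule.mem_colon_singleton]; exact Ideal.mul_mem_right _ _ hs
    have h1 := ih _ (lt_of_le_of_ne hle (Ne.symm hcol)) y hry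
    rw [← sub_add_cancel x (c • y)]
    refine Submodule.add_mem _ hy ?_
    obtain ⟨k, s, z, hs, rfl⟩ := Submodule.exists_sum_of_mem_map_smul_top h1
    rw [Finset.smul_sum]
    refine Submodule.sum_mem _ fun i _ => ?_
    rw [smul_smul]
    refine Submodule.algebraMap_smul_mem_map_smul_top ?_ _
    have := Submodule.mem_colon_singleton.mp (hs i)
    rwa [smul_eq_mul, mul_comm] at this

/-- `(X / 𝔠X) / r(X / 𝔠X) ≃ (X / rX) / 𝔠(X / rX)`. -/
noncomputable def QuotSMulTop.quotSMulTopEquiv {R : Type u} [CommRing R] (X : Type u)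
    [AddCommGroup X] [Module R X] (r : R) (𝔠 : Ideal R) :
    QuotSMulTop r (X ⧸ (𝔠 • ⊤ : Submodule R X)) ≃ₗ[R]
      QuotSMulTop r X ⧸ (𝔠 • ⊤ : Submodule R (QuotSMulTop r X)) :=
  Submodule.quotEquivOfEq _ ((r • ⊤ : Submodule R X).map (𝔠 • ⊤ : Submodule R X).mkQ)
      (by rw [Submodule.map_pointwise_smul, Submodule.map_top, Submodule.range_mkQ]) ≪≫ₗ
    Submodule.quotientQuotientEquivQuotientSup _ _ ≪≫ₗ
    Submodule.quotEquivOfEq _ _ (sup_comm _ _) ≪≫ₗ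
    (Submodule.quotientQuotientEquivQuotientSup _ _).symm ≪≫ₗ
    Submodule.quotEquivOfEq ((𝔠 • ⊤ : Submodule R X).map (r • ⊤ : Submodule R X).mkQ) _
      (by rw [Submodule.map_smul'', Submodule.map_top, Submodule.range_mkQ])

open RingTheory.Sequence in
/-- A sequence that is regular on the special fibre of a finite `R`-module flat over `S` is regular
modulo every ideal of `S`. -/
theorem Module.Flat.isWeaklyRegular_quotient {S : Type v} [CommRing S] {R : Type u} [CommRing R]
    [Algebra S R] [IsLocalRing S] [IsNoetherianRing S] [IsLocalRing R] [IsNoetherianRing R]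
    (hloc : maxExt S R ≤ maximalIdeal R) (𝔞 : Ideal S) (rs : List R) :
    ∀ (X : Type u) [AddCommGroup X] [Module R X] [Module S X] [IsScalarTower S R X]
      [Module.Finite R X] [Module.Flat S X],
      IsWeaklyRegular (X ⧸ (maxExt S R • ⊤ : Submodule R X)) rs →
      IsWeaklyRegular (X ⧸ (Ideal.map (algebraMap S R) 𝔞 • ⊤ : Submodule R X)) rs := by
  induction rs with
  | nil => intros; exact .nil _ _
  | cons r rs ih =>
    intro X _ _ _ _ _ _ hreg
    rw [isWeaklyRegular_cons_iff] at hreg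
    obtain ⟨hr, hrs⟩ := hreg
    have hr' : ∀ x : X, r • x ∈ (maxExt S R • ⊤ : Submodule R X) →
        x ∈ (maxExt S R • ⊤ : Submodule R X) := by
      intro x hx
      rw [← Submodule.Quotient.mk_eq_zero] at hx ⊢
      exact hr (by simpa using hx)
    have hall := Module.Flat.mem_smul_top_of_smul_mem hloc hr'
    have hflat : Module.Flat S (QuotSMulTop r X) := Module.Flat.quotSMulTop hall
    refine .cons (fun x y hxy => ?_) ?_
    · obtain ⟨x, rfl⟩ := Submodule.mkQ_surjective _ x
      obtain ⟨y, rfl⟩ := Submodule.mkQ_surjective _ y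
      rw [← sub_eq_zero, ← map_sub, Submodule.mkQ_apply, Submodule.Quotient.mk_eq_zero]
      refine hall 𝔞 _ ?_
      rw [← Submodule.Quotient.mk_eq_zero, Submodule.Quotient.mk_smul, ← Submodule.mkQ_apply,
        map_sub, smul_sub, sub_eq_zero]
      exact hxy
    · rw [(QuotSMulTop.quotSMulTopEquiv X r _).isWeaklyRegular_congr] at hrs ⊢
      exact ih (QuotSMulTop r X) hrs

end FlatBase

/-! ### Rees' isomorphism and the double colon -/

section Rees

open Abelian RingTheory.Sequence

variable {A : Type u} [CommRing A]

theorem ModuleCat.ext_smul_eq_zero {N Y : ModuleCat.{u} A} {r : A} (h : ∀ x : N, r • x = 0)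
    {i : ℕ} (e : Ext N Y i) : r • e = 0 := by
  have h1 : r • 𝟙 N = 0 := by
    ext x
    exact h x
  rw [← Ext.mk₀_id_comp e, ← Ext.smul_comp, ← Ext.mk₀_smul, h1, Ext.mk₀_zero, Ext.zero_comp]

theorem ModuleCat.exists_comp_extClass_smulShortComplex {N Y : ModuleCat.{u} A} {r : A}
    (h : ∀ x : N, r • x = 0) (hr : IsSMulRegular Y r) {i : ℕ} (e : Ext N Y (i + 1)) :
    ∃ z : Ext N (Y.smulShortComplex r).X₃ i,
      z.comp hr.smulShortComplex_shortExact.extClass rfl = e := by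
  refine Ext.covariant_sequence_exact₁ N hr.smulShortComplex_shortExact e ?_ rfl
  rw [ModuleCat.smulShortComplex_f_eq_smul_id]
  exact (Ext.smul_eq_comp_mk₀ e r).symm.trans (ext_smul_eq_zero h e)

/-- The vanishing half of Rees' theorem: `Extⁱ(N, Y) = 0` for `i` less than the length of a
`Y`-regular sequence annihilating `N`. -/
theorem ModuleCat.ext_eq_zero_of_lt_length {N : ModuleCat.{u} A} (rs : List A)
    (hN : ∀ r ∈ rs, ∀ x : N, r • x = 0) : ∀ (Y : ModuleCat.{u} A), IsWeaklyRegular Y rs →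
      ∀ i, i < rs.length → ∀ e : Ext N Y i, e = 0 := by
  induction rs with
  | nil => intro Y _ i hi; simp at hi
  | cons r rs ih =>
    intro Y hreg i hi e
    rw [isWeaklyRegular_cons_iff] at hreg
    have hNr : ∀ x : N, r • x = 0 := hN r (by simp)
    match i with
    | 0 =>
      obtain ⟨f, rfl⟩ := (Ext.mk₀_bijective N Y).2 e
      rw [Ext.mk₀_eq_zero_iff]
      ext x
      refine hreg.1 ?_
      change r • f.hom x = r • (0 : Y)
      rw [← map_smul, hNr, map_zero, smul_zero]
    | i + 1 =>
      obtain ⟨z, rfl⟩ := exists_comp_extClass_smulShortComplex hNr hreg.1 e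
      rw [ih (fun r hr => hN r (by simp [hr])) _ hreg.2 i (by simpa using hi) z, Ext.zero_comp]
      rfl

/-- Rees' isomorphism `Hom(N, Y / (rs)Y) ≃ Extᵈ(N, Y)` for a `Y`-regular sequence `rs` of length `d`
annihilating `N`. It is the Yoneda product with a class in `Extᵈ(Y / (rs)Y, Y)`, which makes it
natural in `N`. -/
theorem ModuleCat.exists_ext_bijective_mk₀_comp (rs : List A) :
    ∀ (Y : Type u) [AddCommGroup Y] [Module A Y], IsWeaklyRegular Y rs →
      ∃ e : Ext (of A (Y ⧸ (Ideal.ofList rs • ⊤ : Submodule A Y))) (of A Y) rs.length,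
        ∀ N : ModuleCat.{u} A, (∀ r ∈ rs, ∀ x : N, r • x = 0) → Function.Bijective
          fun f : N ⟶ of A (Y ⧸ (Ideal.ofList rs • ⊤ : Submodule A Y)) =>
            (Ext.mk₀ f).comp e (zero_add _) := by
  induction rs with
  | nil =>
    intro Y _ _ _
    let ι := (Submodule.quotEquivOfEqBot (Ideal.ofList ([] : List A) • ⊤ : Submodule A Y)
      (by rw [Ideal.ofList_nil, Submodule.bot_smul])).toModuleIso
    refine ⟨Ext.mk₀ ι.hom, fun N _ => ?_⟩
    have : (fun f : N ⟶ of A (Y ⧸ (Ideal.ofList ([] : List A) • ⊤ : Submodule A Y)) =>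
        (Ext.mk₀ f).comp (Ext.mk₀ ι.hom) (zero_add _)) = fun f => Ext.mk₀ (f ≫ ι.hom) := by
      funext f
      exact Ext.mk₀_comp_mk₀ _ _
    rw [this]
    exact (Ext.mk₀_bijective _ _).comp ((Iso.homToEquiv ι).bijective)
  | cons r rs ih =>
    intro Y _ _ hreg
    rw [isWeaklyRegular_cons_iff] at hreg
    obtain ⟨e', he'⟩ := ih (QuotSMulTop r Y) hreg.2
    have hr : IsSMulRegular (of A Y) r := hreg.1
    let ι := (Submodule.quotOfListConsSMulTopEquivQuotSMulTopInner Y r rs).toModuleIso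
    let c : Ext (of A (QuotSMulTop r Y)) (of A Y) 1 := hr.smulShortComplex_shortExact.extClass
    refine ⟨(Ext.mk₀ ι.hom).comp (e'.comp c rfl) (zero_add _), fun N hN => ?_⟩
    have hNr : ∀ x : N, r • x = 0 := hN r (by simp)
    have hNrs : ∀ r ∈ rs, ∀ x : N, r • x = 0 := fun r hr => hN r (by simp [hr])
    have : (fun f : N ⟶ of A (Y ⧸ (Ideal.ofList (r :: rs) • ⊤ : Submodule A Y)) =>
        (Ext.mk₀ f).comp ((Ext.mk₀ ι.hom).comp (e'.comp c rfl) (zero_add _)) (zero_add _)) =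
        (fun z : Ext N (of A (QuotSMulTop r Y)) rs.length => z.comp c rfl) ∘
        (fun g => (Ext.mk₀ g).comp e' (zero_add _)) ∘ fun f => f ≫ ι.hom := by
      funext f
      simp only [Function.comp_apply]
      rw [Ext.mk₀_comp_mk₀_assoc, Ext.comp_assoc _ _ _ _ rfl (by simp)]
    rw [this]
    refine Function.Bijective.comp ⟨?_, ?_⟩ ((he' N hNrs).comp (Iso.homToEquiv ι).bijective)
    · have hinj : Function.Injective (c.postcomp N (rfl : rs.length + 1 = rs.length + 1)) := by
        rw [injective_iff_map_eq_zero]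
        intro z hz
        obtain ⟨w, rfl⟩ := Ext.covariant_sequence_exact₃ N hr.smulShortComplex_shortExact z rfl hz
        have hw : w = 0 := ext_eq_zero_of_lt_length (r :: rs) hN (of A Y)
          (.cons hreg.1 hreg.2) rs.length (by simp) w
        rw [hw]
        apply Ext.zero_comp
      exact hinj
    · exact fun e => exists_comp_extClass_smulShortComplex hNr hr e

/-- By naturality of Rees' isomorphism in `Y`, the map `Extᵈ(N, Y) → Extᵈ(N, Y')` is surjective as
soon as every map `N → Y' / (rs)Y'` lifts to `Y / (rs)Y`. -/
theorem ModuleCat.exists_ext_comp_mk₀_eq (rs : List A) {N : ModuleCat.{u} A}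
    (hN : ∀ r ∈ rs, ∀ x : N, r • x = 0) :
    ∀ (Y Y' : Type u) [AddCommGroup Y] [Module A Y] [AddCommGroup Y'] [Module A Y']
      (φ : Y →ₗ[A] Y'), IsWeaklyRegular Y rs → IsWeaklyRegular Y' rs →
      (∀ f : N →ₗ[A] Y' ⧸ (Ideal.ofList rs • ⊤ : Submodule A Y'),
        ∃ g : N →ₗ[A] Y ⧸ (Ideal.ofList rs • ⊤ : Submodule A Y),
          Submodule.mapQ _ _ φ (Submodule.smul_top_le_comap_smul_top _ _) ∘ₗ g = f) →
      ∀ e' : Ext N (of A Y') rs.length,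
        ∃ e : Ext N (of A Y) rs.length, e.comp (Ext.mk₀ (ofHom φ)) (add_zero _) = e' := by
  induction rs with
  | nil =>
    intro Y Y' _ _ _ _ φ _ _ hφ e'
    obtain ⟨f, rfl⟩ := (Ext.mk₀_bijective _ _).2 e'
    obtain ⟨g, hg⟩ := hφ ((Submodule.mkQ _) ∘ₗ f.hom)
    let ι := Submodule.quotEquivOfEqBot (Ideal.ofList ([] : List A) • ⊤ : Submodule A Y)
      (by rw [Ideal.ofList_nil, Submodule.bot_smul])
    refine ⟨Ext.mk₀ (ofHom (ι.toLinearMap ∘ₗ g)), ?_⟩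
    rw [Ext.mk₀_comp_mk₀]
    congr 1
    ext x
    have h1 := LinearMap.congr_fun hg x
    obtain ⟨y, hy⟩ := Submodule.mkQ_surjective _ (g x)
    simp only [LinearMap.comp_apply, ← hy] at h1
    have h2 : φ y - f.hom x ∈ (Ideal.ofList ([] : List A) • ⊤ : Submodule A Y') :=
      (Submodule.Quotient.eq _).mp h1
    simp only [Ideal.ofList_nil, Submodule.bot_smul, Submodule.mem_bot, sub_eq_zero] at h2
    change φ (ι (g x)) = f.hom x
    rw [← hy, ← h2]
    rfl
  | cons r rs ih =>
    intro Y Y' _ _ _ _ φ hY hY' hφ e'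
    rw [isWeaklyRegular_cons_iff] at hY hY'
    have hNr : ∀ x : N, r • x = 0 := hN r (by simp)
    have hr : IsSMulRegular (of A Y) r := hY.1
    have hr' : IsSMulRegular (of A Y') r := hY'.1
    obtain ⟨z', rfl⟩ := exists_comp_extClass_smulShortComplex hNr hr' e'
    let T : (of A Y).smulShortComplex r ⟶ (of A Y').smulShortComplex r :=
      { τ₁ := ofHom φ
        τ₂ := ofHom φ
        τ₃ := ofHom (QuotSMulTop.map r φ)
        comm₁₂ := by ext x; exact (φ.map_smul r x).symm
        comm₂₃ := by ext x; rfl }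
    obtain ⟨z, hz⟩ := ih (fun r hr => hN r (by simp [hr])) (QuotSMulTop r Y) (QuotSMulTop r Y')
      (QuotSMulTop.map r φ) hY.2 hY'.2 (fun f => by
        let ι := Submodule.quotOfListConsSMulTopEquivQuotSMulTopInner Y r rs
        let ι' := Submodule.quotOfListConsSMulTopEquivQuotSMulTopInner Y' r rs
        obtain ⟨g, hg⟩ := hφ (ι'.symm.toLinearMap ∘ₗ f)
        refine ⟨ι.toLinearMap ∘ₗ g, ?_⟩
        rw [← LinearMap.comp_assoc,
          ← Submodule.quotOfListConsSMulTopEquivQuotSMulTopInner_naturality,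
          LinearMap.comp_assoc, hg]
        ext x
        simp [ι']) z'
    let c : Ext (of A (QuotSMulTop r Y)) (of A Y) 1 := hr.smulShortComplex_shortExact.extClass
    let c' : Ext (of A (QuotSMulTop r Y')) (of A Y') 1 := hr'.smulShortComplex_shortExact.extClass
    have hnat : c.comp (Ext.mk₀ (ofHom φ)) (add_zero 1) =
        (Ext.mk₀ (ofHom (QuotSMulTop.map r φ))).comp c' (zero_add 1) :=
      ShortComplex.ShortExact.extClass_naturality hr.smulShortComplex_shortExact
        hr'.smulShortComplex_shortExact T
    refine ⟨z.comp c rfl, ?_⟩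
    change _ = z'.comp c' rfl
    rw [Ext.comp_assoc_of_third_deg_zero, hnat, ← hz]
    exact (Ext.comp_assoc_of_second_deg_zero _ _ _ _).symm

theorem ModuleCat.hasProjectiveDimensionLE_quotient_ofList (rs : List A) :
    ∀ (c : ℕ) (Y : Type u) [AddCommGroup Y] [Module A Y], IsWeaklyRegular Y rs →
      HasProjectiveDimensionLE (of A Y) c →
      HasProjectiveDimensionLE (of A (Y ⧸ (Ideal.ofList rs • ⊤ : Submodule A Y)))
        (c + rs.length) := by
  induction rs with
  | nil =>
    intro c Y _ _ _ hY
    have : HasProjectiveDimensionLT (of A Y) (c + 1) := hY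
    exact hasProjectiveDimensionLT_of_iso (Submodule.quotEquivOfEqBot
      (Ideal.ofList ([] : List A) • ⊤ : Submodule A Y)
      (by rw [Ideal.ofList_nil, Submodule.bot_smul])).toModuleIso.symm (c + 1)
  | cons r rs ih =>
    intro c Y _ _ hreg hY
    rw [isWeaklyRegular_cons_iff] at hreg
    have hr : IsSMulRegular (of A Y) r := hreg.1
    have : HasProjectiveDimensionLT (of A Y) (c + 1) := hY
    have h1 : HasProjectiveDimensionLE (of A (QuotSMulTop r Y)) (c + 1) :=
      hr.smulShortComplex_shortExact.hasProjectiveDimensionLT_X₃ (c + 1) hY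
        (hasProjectiveDimensionLT_of_ge (of A Y) (c + 1) (c + 1 + 1) (by omega))
    have h2 := ih (c + 1) (QuotSMulTop r Y) hreg.2 h1
    rw [show c + 1 + rs.length = c + (r :: rs).length by simp; omega] at h2
    exact hasProjectiveDimensionLT_of_iso
      (Submodule.quotOfListConsSMulTopEquivQuotSMulTopInner Y r rs).toModuleIso.symm _

/-- The elements `y` of `Y` that `((rs) : h)` multiplies into `(rs)Y`. -/
def doubleColon (rs : List A) (h : A) (Y : Type u) [AddCommGroup Y] [Module A Y] :
    Submodule A Y where
  carrier := {y | ∀ a, a * h ∈ Ideal.ofList rs → a • y ∈ (Ideal.ofList rs • ⊤ : Submodule A Y)}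
  add_mem' hx hy a ha := by
    rw [smul_add]
    exact Submodule.add_mem _ (hx a ha) (hy a ha)
  zero_mem' a _ := by
    rw [smul_zero]
    exact Submodule.zero_mem _
  smul_mem' c y hy a ha := by
    rw [smul_comm]
    exact Submodule.smul_mem _ _ (hy a ha)

theorem mem_doubleColon {rs : List A} {h : A} {Y : Type u} [AddCommGroup Y] [Module A Y] {y : Y} :
    y ∈ doubleColon rs h Y ↔
      ∀ a, a * h ∈ Ideal.ofList rs → a • y ∈ (Ideal.ofList rs • ⊤ : Submodule A Y) :=
  Iff.rfl

/-- If `rs` is a regular sequence of length `d` on `A` and on `Y`, then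
`Extᵈ⁺¹(A / (rs, h), Y)` is the double colon `((rs)Y : ((rs) : h))` modulo `(rs, h)Y`: the exact
sequence `0 → A / ((rs) : h) → A / (rs) → A / (rs, h) → 0`, whose first map is multiplication by
`h`, exhibits this `Ext` as a cokernel of groups `Extᵈ(-, Y)`, to which Rees' isomorphism
applies. -/
theorem exists_doubleColon_linearMap_ext {rs : List A} (h : A) {𝔧 : Ideal A}
    (h𝔧 : Ideal.ofList rs ⊔ Ideal.span {h} = 𝔧) (Y : Type u) [AddCommGroup Y] [Module A Y]
    (hA : IsWeaklyRegular A rs) (hY : IsWeaklyRegular Y rs) :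
    ∃ ψ : doubleColon rs h Y →ₗ[A] Ext (ModuleCat.of A (A ⧸ 𝔧)) (ModuleCat.of A Y) (rs.length + 1),
      Function.Surjective ψ ∧ ∀ y, ψ y = 0 ↔ (y : Y) ∈ (𝔧 • ⊤ : Submodule A Y) := by
  obtain ⟨e, he⟩ := ModuleCat.exists_ext_bijective_mk₀_comp rs Y hY
  let 𝔤 := Ideal.ofList rs
  let 𝔨 : Ideal A := Submodule.colon 𝔤 {h}
  have hmem𝔨 (a : A) : a ∈ 𝔨 ↔ a * h ∈ 𝔤 := Submodule.mem_colon_singleton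
  let α : (A ⧸ 𝔨) →ₗ[A] A ⧸ 𝔤 := Submodule.liftQ 𝔨 ((Submodule.mkQ 𝔤) ∘ₗ LinearMap.mulRight A h)
    fun a ha => by
      rw [LinearMap.mem_ker, LinearMap.comp_apply, Submodule.mkQ_apply,
        Submodule.Quotient.mk_eq_zero]
      exact (hmem𝔨 a).mp ha
  have hα (a : A) : α (Submodule.Quotient.mk a) = Submodule.Quotient.mk (a * h) := rfl
  let β : (A ⧸ 𝔤) →ₗ[A] A ⧸ 𝔧 := Submodule.factor (h𝔧 ▸ le_sup_left)
  have hβ (a : A) : β (Submodule.Quotient.mk a) = Submodule.Quotient.mk a := rfl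
  have hinj : Function.Injective α := by
    rw [injective_iff_map_eq_zero]
    intro z hz
    obtain ⟨a, rfl⟩ := Submodule.mkQ_surjective _ z
    rw [Submodule.mkQ_apply, hα, Submodule.Quotient.mk_eq_zero] at hz
    rw [Submodule.mkQ_apply, Submodule.Quotient.mk_eq_zero]
    exact (hmem𝔨 a).mpr hz
  have hsurj : Function.Surjective β := Submodule.factor_surjective _
  have hex : Function.Exact α β := by
    intro z
    obtain ⟨a, rfl⟩ := Submodule.mkQ_surjective _ z
    rw [Submodule.mkQ_apply, hβ, Submodule.Quotient.mk_eq_zero]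
    constructor
    · intro ha
      rw [← h𝔧, Submodule.mem_sup] at ha
      obtain ⟨g, hg, w, hw, rfl⟩ := ha
      obtain ⟨b, rfl⟩ := Ideal.mem_span_singleton'.mp hw
      refine ⟨Submodule.Quotient.mk b, ?_⟩
      rw [hα, Submodule.Quotient.eq]
      simpa using Submodule.neg_mem _ hg
    · rintro ⟨b, hb⟩
      obtain ⟨b, rfl⟩ := Submodule.mkQ_surjective _ b
      rw [Submodule.mkQ_apply, hα, Submodule.Quotient.eq] at hb
      rw [← h𝔧]
      have h1 : b * h ∈ Ideal.span {h} := Ideal.mul_mem_left _ _ (Ideal.mem_span_singleton_self h)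
      have h2 := Submodule.sub_mem _ (Ideal.mem_sup_right (S := 𝔤) h1) (Ideal.mem_sup_left hb)
      simpa using h2
  let T : ShortComplex (ModuleCat.{u} A) := ModuleCat.shortComplexOfCompEqZero α β
    hex.linearMap_comp_eq_zero
  have hT : T.ShortExact := ModuleCat.shortComplex_shortExact T hex hinj hsurj
  have hrs𝔤 : ∀ r ∈ rs, r ∈ 𝔤 := fun r hr => Ideal.subset_span hr
  have hN𝔤 : ∀ r ∈ rs, ∀ x : ModuleCat.of A (A ⧸ 𝔤), r • x = 0 := by
    intro r hr x
    obtain ⟨a, rfl⟩ := Submodule.mkQ_surjective _ x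
    rw [← map_smul, Submodule.mkQ_apply, Submodule.Quotient.mk_eq_zero]
    exact Ideal.mul_mem_right _ _ (hrs𝔤 r hr)
  have hN𝔨 : ∀ r ∈ rs, ∀ x : ModuleCat.of A (A ⧸ 𝔨), r • x = 0 := by
    intro r hr x
    obtain ⟨a, rfl⟩ := Submodule.mkQ_surjective _ x
    rw [← map_smul, Submodule.mkQ_apply, Submodule.Quotient.mk_eq_zero, hmem𝔨, smul_eq_mul,
      mul_assoc]
    exact Ideal.mul_mem_right _ _ (hrs𝔤 r hr)
  -- The map `A / ((rs) : h) → Y / (rs)Y` sending `1` to the class of `y`, linearly in `y`.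
  let γ : doubleColon rs h Y →ₗ[A] (A ⧸ 𝔨) →ₗ[A] Y ⧸ (𝔤 • ⊤ : Submodule A Y) :=
    { toFun y := Submodule.liftQ 𝔨 (LinearMap.toSpanSingleton A _ (Submodule.Quotient.mk (y : Y)))
        fun a ha => by
          rw [LinearMap.mem_ker, LinearMap.toSpanSingleton_apply, ← Submodule.Quotient.mk_smul,
            Submodule.Quotient.mk_eq_zero]
          exact mem_doubleColon.mp y.2 a ((hmem𝔨 a).mp ha)
      map_add' y y' := by
        refine LinearMap.ext fun z => ?_
        obtain ⟨b, rfl⟩ := Submodule.mkQ_surjective _ z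
        exact smul_add b (Submodule.Quotient.mk (y : Y) : Y ⧸ (𝔤 • ⊤ : Submodule A Y))
          (Submodule.Quotient.mk (y' : Y))
      map_smul' a y := by
        refine LinearMap.ext fun z => ?_
        obtain ⟨b, rfl⟩ := Submodule.mkQ_surjective _ z
        exact smul_comm b a (Submodule.Quotient.mk (y : Y) : Y ⧸ (𝔤 • ⊤ : Submodule A Y)) }
  have hγ (y : doubleColon rs h Y) (a : A) :
      γ y (Submodule.Quotient.mk a) = Submodule.Quotient.mk (a • (y : Y)) := rfl
  let ψ : doubleColon rs h Y →ₗ[A] Ext (ModuleCat.of A (A ⧸ 𝔧)) (ModuleCat.of A Y)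
      (rs.length + 1) :=
    { toFun y := hT.extClass.comp ((Ext.mk₀ (ModuleCat.ofHom (γ y))).comp e (zero_add _))
        (add_comm 1 _)
      map_add' y y' := by
        rw [map_add, ModuleCat.ofHom_add, Ext.mk₀_add, Ext.add_comp, Ext.comp_add]
      map_smul' a y := by
        have h1 : ModuleCat.ofHom (γ (a • y)) = a • ModuleCat.ofHom (γ y) := by
          rw [map_smul]
          rfl
        rw [h1, Ext.mk₀_smul, Ext.smul_comp, Ext.comp_smul]
        rfl }
  have hψ (y : doubleColon rs h Y) : ψ y =
    hT.extClass.comp ((Ext.mk₀ (ModuleCat.ofHom (γ y))).comp e (zero_add _)) (add_comm 1 _) := rfl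
  refine ⟨ψ, fun x => ?_, fun y => ?_⟩
  · have hpd : HasProjectiveDimensionLE (ModuleCat.of A (A ⧸ 𝔤)) rs.length := by
      have hp : Projective (ModuleCat.of A A) :=
        (IsProjective.iff_projective _).mp inferInstance
      have h1 := ModuleCat.hasProjectiveDimensionLE_quotient_ofList rs 0 A hA
        ((projective_iff_hasProjectiveDimensionLE_zero _).mp hp)
      rw [zero_add] at h1
      exact hasProjectiveDimensionLT_of_iso (Submodule.quotEquivOfEq
        (Ideal.ofList rs • ⊤ : Submodule A A) 𝔤
        (by rw [Ideal.smul_eq_mul, Ideal.mul_top])).toModuleIso _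
    have hx : (Ext.mk₀ T.g).comp x (zero_add _) = 0 :=
      Ext.eq_zero_of_hasProjectiveDimensionLT (X := ModuleCat.of A (A ⧸ 𝔤)) _ (rs.length + 1)
        le_rfl
    obtain ⟨x₁, rfl⟩ := Ext.contravariant_sequence_exact₃ hT _ x hx (add_comm 1 _)
    obtain ⟨g, rfl⟩ := (he (ModuleCat.of A (A ⧸ 𝔨)) hN𝔨).2 x₁
    obtain ⟨y, hy⟩ := Submodule.mkQ_surjective _ (g.hom (Submodule.Quotient.mk (1 : A)))
    have hga (a : A) : g.hom (Submodule.Quotient.mk a) = Submodule.Quotient.mk (a • y) := by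
      have h1 : (Submodule.Quotient.mk a : A ⧸ 𝔨) = a • Submodule.Quotient.mk (1 : A) := by
        rw [← Submodule.Quotient.mk_smul, smul_eq_mul, mul_one]
      rw [h1, Submodule.Quotient.mk_smul]
      exact (map_smul g.hom a _).trans (congrArg (a • ·) hy.symm)
    have hy' : y ∈ doubleColon rs h Y := by
      intro a ha
      rw [← Submodule.Quotient.mk_eq_zero, ← hga, (Submodule.Quotient.mk_eq_zero _).mpr
        ((hmem𝔨 a).mpr ha), map_zero]
    refine ⟨⟨y, hy'⟩, ?_⟩
    rw [hψ]
    congr 3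
    refine ModuleCat.hom_ext (LinearMap.ext fun z => ?_)
    obtain ⟨a, rfl⟩ := Submodule.mkQ_surjective _ z
    exact (hga a).symm
  · rw [hψ]
    constructor
    · intro h0
      obtain ⟨x₂, hx₂⟩ := Ext.contravariant_sequence_exact₁ hT _ _ (add_comm 1 _) h0
      obtain ⟨k, rfl⟩ := (he (ModuleCat.of A (A ⧸ 𝔤)) hN𝔤).2 x₂
      have h1 : (Ext.mk₀ (T.f ≫ k)).comp e (zero_add _) =
          (Ext.mk₀ (ModuleCat.ofHom (γ y))).comp e (zero_add _) := by
        rw [← hx₂]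
        exact (Ext.mk₀_comp_mk₀_assoc _ _ _).symm
      have h2 : T.f ≫ k = ModuleCat.ofHom (γ y) := (he _ hN𝔨).1 h1
      have h3 := LinearMap.congr_fun (congrArg ModuleCat.Hom.hom h2)
        (Submodule.Quotient.mk (1 : A))
      obtain ⟨z, hz⟩ := Submodule.mkQ_surjective _ (k.hom (Submodule.Quotient.mk (1 : A)))
      have h4 : (Submodule.Quotient.mk (h • z) : Y ⧸ (𝔤 • ⊤ : Submodule A Y)) =
          Submodule.Quotient.mk (y : Y) := by
        have h5 : k.hom (Submodule.Quotient.mk (1 * h)) =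
            (Submodule.Quotient.mk ((1 : A) • (y : Y)) : Y ⧸ (𝔤 • ⊤ : Submodule A Y)) := h3
        have h6 : (Submodule.Quotient.mk (1 * h) : A ⧸ 𝔤) =
            h • (Submodule.Quotient.mk (1 : A)) := by
          rw [← Submodule.Quotient.mk_smul, smul_eq_mul, mul_comm]
        rw [one_smul, h6] at h5
        rw [← h5, Submodule.Quotient.mk_smul]
        exact ((map_smul k.hom h _).trans (congrArg (h • ·) hz.symm)).symm
      rw [Submodule.Quotient.eq] at h4
      rw [← sub_sub_cancel (h • z) (y : Y), ← h𝔧]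
      exact Submodule.sub_mem _ (Submodule.smul_mem_smul
        (Ideal.mem_sup_right (Ideal.mem_span_singleton_self h)) trivial)
        (Submodule.smul_mono_left le_sup_left h4)
    · intro hy
      rw [← h𝔧, Submodule.sup_smul, Submodule.ideal_span_singleton_smul, Submodule.mem_sup] at hy
      obtain ⟨w, hw, w', ⟨z, -, rfl⟩, hwz⟩ := hy
      let k : (A ⧸ 𝔤) →ₗ[A] Y ⧸ (𝔤 • ⊤ : Submodule A Y) :=
        Submodule.liftQ 𝔤 (LinearMap.toSpanSingleton A _ (Submodule.Quotient.mk z))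
          fun a ha => by
            rw [LinearMap.mem_ker, LinearMap.toSpanSingleton_apply, ← Submodule.Quotient.mk_smul,
              Submodule.Quotient.mk_eq_zero]
            exact Submodule.smul_mem_smul ha trivial
      have hk : ModuleCat.ofHom (γ y) = T.f ≫ ModuleCat.ofHom k := by
        refine ModuleCat.hom_ext (LinearMap.ext fun z' => ?_)
        obtain ⟨a, rfl⟩ := Submodule.mkQ_surjective _ z'
        change (Submodule.Quotient.mk (a • (y : Y)) : Y ⧸ (𝔤 • ⊤ : Submodule A Y)) =
          Submodule.Quotient.mk ((a * h) • z)
        rw [Submodule.Quotient.eq, ← hwz, smul_add, mul_smul]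
        simpa using Submodule.smul_mem _ a hw
      rw [hk, ← Ext.mk₀_comp_mk₀_assoc]
      exact hT.extClass_comp_assoc _

end Rees

/-! ### Devissage, depth and prime avoidance -/

section Devissage

open Abelian RingTheory.Sequence

theorem ModuleCat.ext_eq_zero_of_iso {A : Type u} [CommRing A] {N N' Y : ModuleCat.{u} A}
    (ι : N ≅ N') {i : ℕ} (h : ∀ e : Ext N' Y i, e = 0) (e : Ext N Y i) : e = 0 := by
  rw [← Ext.mk₀_id_comp e, ← ι.hom_inv_id, ← Ext.mk₀_comp_mk₀_assoc, h ((Ext.mk₀ ι.inv).comp e _),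
    Ext.comp_zero]

theorem Ideal.Quotient.isSMulRegular_of_notMem {A : Type u} [CommRing A] {𝔭 : Ideal A}
    [h𝔭 : 𝔭.IsPrime] {x : A} (hx : x ∉ 𝔭) : IsSMulRegular (A ⧸ 𝔭) x := by
  refine IsSMulRegular.of_right_eq_zero_of_smul fun z hz => ?_
  obtain ⟨a, rfl⟩ := Ideal.Quotient.mk_surjective z
  rw [← Ideal.Quotient.mkₐ_eq_mk A, ← map_smul, Ideal.Quotient.mkₐ_eq_mk,
    Ideal.Quotient.eq_zero_iff_mem] at hz
  exact Ideal.Quotient.eq_zero_iff_mem.mpr ((h𝔭.mem_or_mem hz).resolve_left hx)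

variable {A : Type u} [CommRing A] [IsLocalRing A] [IsNoetherianRing A]

/-- Nakayama's lemma for `Ext`: if `x ∈ 𝔪` is `N`-regular and `Extⁱ⁺¹(N / xN, Y) = 0`, then `x` acts
surjectively on the finite module `Extⁱ(N, Y)`, which therefore vanishes. -/
theorem ModuleCat.ext_eq_zero_of_quotSMulTop {N Y : ModuleCat.{u} A} [Module.Finite A N]
    [Module.Finite A Y] {x : A} (hx : x ∈ maximalIdeal A) (hr : IsSMulRegular N x) {i : ℕ}
    (h : ∀ e : Ext (of A (QuotSMulTop x N)) Y (i + 1), e = 0) (e : Ext N Y i) : e = 0 := by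
  have hfin : Module.Finite A (Ext N Y i) := ModuleCat.finite_ext A N Y i
  have htop : (⊤ : Submodule A (Ext N Y i)) = ⊥ := by
    refine Submodule.eq_bot_of_le_smul_of_le_jacobson_bot (maximalIdeal A) _ hfin.fg_top
      (fun e _ => ?_) (maximalIdeal_le_jacobson _)
    obtain ⟨e', he'⟩ := Ext.contravariant_sequence_exact₁ hr.smulShortComplex_shortExact Y e
      (add_comm 1 i) (h _)
    have h1 (e' : Ext N Y i) : (Ext.mk₀ (x • 𝟙 N)).comp e' (zero_add i) = x • e' := by
      rw [Ext.mk₀_smul, Ext.smul_comp, Ext.mk₀_id_comp]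
    have h2 : e = x • (e' : Ext N Y i) := he'.symm.trans (h1 e')
    exact h2 ▸ Submodule.smul_mem_smul hx trivial
  exact (Submodule.mem_bot A).mp (htop ▸ Submodule.mem_top)

/-- If `Extⁿ⁺¹(-, Y)` vanishes on finite modules, then `Extⁿ(N, Y)` has finite length; stated as
annihilation by a power of the maximal ideal. -/
theorem ModuleCat.exists_pow_maximalIdeal_smul_ext_eq_zero (Y : ModuleCat.{u} A)
    [Module.Finite A Y] (n : ℕ)
    (h : ∀ (N : Type u) [AddCommGroup N] [Module A N] [Module.Finite A N],
      ∀ e : Ext (of A N) Y (n + 1), e = 0)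
    (N : Type u) [AddCommGroup N] [Module A N] [hN : Module.Finite A N] :
    ∃ k : ℕ, ∀ a ∈ maximalIdeal A ^ k, ∀ e : Ext (of A N) Y n, a • e = 0 := by
  induction hN using IsNoetherianRing.induction_on_isQuotientEquivQuotientPrime A with
  | subsingleton N =>
    exact ⟨0, fun a _ => ext_smul_eq_zero (N := of A N) fun x => Subsingleton.elim (α := N) _ _⟩
  | quotient N 𝔭 ι =>
    have := 𝔭.2
    by_cases h𝔭 : maximalIdeal A ≤ 𝔭.asIdeal
    · refine ⟨1, fun a ha => ext_smul_eq_zero (N := of A N) fun x => ι.injective ?_⟩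
      obtain ⟨b, hb⟩ := Ideal.Quotient.mk_surjective (ι x)
      rw [map_smul, map_zero, ← hb, ← Ideal.Quotient.mkₐ_eq_mk A, ← map_smul,
        Ideal.Quotient.mkₐ_eq_mk, Ideal.Quotient.eq_zero_iff_mem]
      exact Ideal.mul_mem_right _ _ (h𝔭 (by simpa using ha))
    · obtain ⟨x, hx, hx𝔭⟩ := SetLike.not_le_iff_exists.mp h𝔭
      have hreg := Ideal.Quotient.isSMulRegular_of_notMem hx𝔭
      refine ⟨0, fun a _ e => ?_⟩
      rw [ext_eq_zero_of_iso ι.toModuleIso (ext_eq_zero_of_quotSMulTop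
        (N := of A (A ⧸ 𝔭.asIdeal)) hx hreg (h _)) e, smul_zero]
  | exact N₁ N₂ N₃ f g hf hg hfg h₁ h₃ =>
    obtain ⟨k₁, hk₁⟩ := h₁
    obtain ⟨k₃, hk₃⟩ := h₃
    let T : ShortComplex (ModuleCat.{u} A) :=
      ModuleCat.shortComplexOfCompEqZero f g hfg.linearMap_comp_eq_zero
    have hT : T.ShortExact := ModuleCat.shortComplex_shortExact T hfg hf hg
    refine ⟨k₃ + k₁, fun a ha e => ?_⟩
    rw [pow_add] at ha
    induction ha using Submodule.mul_induction_on' with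
    | mem_mul_mem a ha b hb =>
      obtain ⟨e', he'⟩ := Ext.contravariant_sequence_exact₂ hT Y (b • e) (by
        rw [Ext.comp_smul]
        exact hk₁ b hb _)
      rw [mul_smul, ← he', ← Ext.comp_smul, hk₃ a ha e', Ext.comp_zero]
    | add a _ b _ ha hb => rw [add_smul, ha, hb, add_zero]

theorem ModuleCat.ext_eq_zero_of_pow_maximalIdeal_le_annihilator {Y : ModuleCat.{u} A} {i : ℕ}
    (h : ∀ e : Ext (of A (A ⧸ maximalIdeal A)) Y i, e = 0)
    (N : Type u) [AddCommGroup N] [Module A N] [hN : Module.Finite A N] {k : ℕ}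
    (hk : maximalIdeal A ^ k ≤ Module.annihilator A N) : ∀ e : Ext (of A N) Y i, e = 0 := by
  induction hN using IsNoetherianRing.induction_on_isQuotientEquivQuotientPrime A with
  | subsingleton N =>
    intro e
    rw [← one_smul A e]
    exact ext_smul_eq_zero (N := of A N) (fun x => Subsingleton.elim (α := N) _ _) e
  | quotient N 𝔭 ι =>
    have := 𝔭.2
    have h𝔭 : 𝔭.asIdeal = maximalIdeal A := by
      refine le_antisymm (le_maximalIdeal this.ne_top) ?_
      rw [ι.annihilator_eq, Ideal.annihilator_quotient] at hk
      exact this.le_of_pow_le hk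
    exact ext_eq_zero_of_iso (ι.trans (Submodule.quotEquivOfEq _ _ h𝔭)).toModuleIso h
  | exact N₁ N₂ N₃ f g hf hg hfg h₁ h₃ =>
    let T : ShortComplex (ModuleCat.{u} A) :=
      ModuleCat.shortComplexOfCompEqZero f g hfg.linearMap_comp_eq_zero
    have hT : T.ShortExact := ModuleCat.shortComplex_shortExact T hfg hf hg
    intro e
    obtain ⟨e', rfl⟩ := Ext.contravariant_sequence_exact₂ hT Y e
      (h₁ (hk.trans (f.annihilator_le_of_injective hf)) _)
    have h0 : e' = 0 := h₃ (hk.trans (g.annihilator_le_of_surjective hg)) e'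
    rw [h0, Ext.comp_zero]

end Devissage

section CohenMacaulay

open Abelian RingTheory.Sequence

theorem IsRegularLocalRing.exists_isWeaklyRegular (n : ℕ) :
    ∀ (A : Type u) [CommRing A] [IsRegularLocalRing A], ringKrullDim A = n →
      ∃ rs : List A, rs.length = n ∧ (∀ r ∈ rs, r ∈ maximalIdeal A) ∧ IsWeaklyRegular A rs := by
  induction n with
  | zero => exact fun A _ _ _ => ⟨[], rfl, by simp, .nil _ _⟩
  | succ n ih =>
    intro A _ _ hn
    obtain ⟨x, hx, hx2, -⟩ := exists_mem_maximalIdeal_notMem_sq hn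
    obtain ⟨h1, h2⟩ := quotient_span_singleton hn hx hx2
    have := isDomain (n + 1) A hn
    obtain ⟨rs, hlen, hrs, hreg⟩ := ih _ h2
    obtain ⟨rs, rfl⟩ := List.map_surjective_iff.mpr
      (Ideal.Quotient.mk_surjective (I := Ideal.span {x})) rs
    refine ⟨x :: rs, by simpa using hlen, ?_, ?_⟩
    · intro r hr
      rcases List.mem_cons.mp hr with rfl | hr
      · exact hx
      · have h3 := hrs _ (List.mem_map_of_mem hr)
        rw [mem_maximalIdeal, mem_nonunits_iff] at h3 ⊢
        exact fun h4 => h3 (h4.map _)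
    · rw [isWeaklyRegular_cons_iff]
      have hx0 : x ≠ 0 := fun h0 => hx2 (h0 ▸ Ideal.zero_mem _)
      refine ⟨IsSMulRegular.of_right_eq_zero_of_smul fun y hy => by simpa [hx0] using hy, ?_⟩
      have h3 := (isWeaklyRegular_map_algebraMap_iff (A ⧸ Ideal.span {x}) (A ⧸ Ideal.span {x})
        rs).mp hreg
      refine ((Submodule.quotEquivOfEq _ _ ?_).isWeaklyRegular_congr rs).mp h3
      rw [← Submodule.ideal_span_singleton_smul, smul_eq_mul, Ideal.mul_top]

variable {A : Type u} [CommRing A]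

theorem IsRegularLocalRing.ext_residueField_eq_zero [IsRegularLocalRing A] {n : ℕ}
    (hn : ringKrullDim A = n) {i : ℕ} (hi : i < n) :
    ∀ e : Ext (ModuleCat.of A (A ⧸ maximalIdeal A)) (ModuleCat.of A A) i, e = 0 := by
  obtain ⟨rs, hlen, hrs, hreg⟩ := exists_isWeaklyRegular n A hn
  refine ModuleCat.ext_eq_zero_of_lt_length rs (fun r hr x => ?_) _ hreg i (hlen ▸ hi)
  obtain ⟨a, rfl⟩ := Submodule.mkQ_surjective _ x
  rw [← map_smul, Submodule.mkQ_apply, Submodule.Quotient.mk_eq_zero]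
  exact Ideal.mul_mem_right _ _ (hrs r hr)

/-- A case of the bound `grade 𝔭 ≥ height 𝔭` in a Cohen-Macaulay ring. -/
theorem IsRegularLocalRing.ext_quotient_prime_eq_zero [IsRegularLocalRing A] {n : ℕ}
    (hn : ringKrullDim A = n) {𝔭 : Ideal A} [h𝔭 : 𝔭.IsPrime] (hht : n ≤ 𝔭.height + 1) {i : ℕ}
    (hi : i + 2 ≤ n) :
    ∀ e : Ext (ModuleCat.of A (A ⧸ 𝔭)) (ModuleCat.of A A) i, e = 0 := by
  by_cases hle : maximalIdeal A ≤ 𝔭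
  · obtain rfl : 𝔭 = maximalIdeal A := le_antisymm (le_maximalIdeal h𝔭.ne_top) hle
    exact ext_residueField_eq_zero hn (by omega)
  obtain ⟨x, hx, hx𝔭⟩ := SetLike.not_le_iff_exists.mp hle
  have hm : (maximalIdeal A).height = n := by
    have h1 := maximalIdeal_height_eq_ringKrullDim (R := A)
    rw [hn] at h1
    exact_mod_cast h1
  -- By the height bound the maximal ideal is the only prime strictly containing `𝔭`.
  have hrad : maximalIdeal A ≤ (𝔭 ⊔ Ideal.span {x}).radical := by
    rw [Ideal.radical_eq_sInf]
    refine le_sInf fun 𝔮 ⟨h𝔮, h𝔮p⟩ => ?_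
    by_contra hlt
    have h1 : 𝔭 < 𝔮 := lt_of_le_of_ne (le_sup_left.trans h𝔮) fun h => hx𝔭 (h ▸ h𝔮
      (Ideal.mem_sup_right (Ideal.mem_span_singleton_self x)))
    have h2 : 𝔮 < maximalIdeal A := lt_of_le_not_ge (le_maximalIdeal h𝔮p.ne_top) hlt
    have h3 := Ideal.height_add_one_le_of_lt_of_isPrime h1
    have h4 := Ideal.height_add_one_le_of_lt_of_isPrime h2
    rw [hm] at h4
    have h5 : 𝔮.height ≠ ⊤ := ((le_self_add.trans h4).trans_lt (ENat.natCast_lt_top n)).ne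
    lift 𝔮.height to ℕ using h5 with b hb
    have h6 : 𝔭.height ≠ ⊤ := ((le_self_add.trans h3).trans_lt (ENat.natCast_lt_top b)).ne
    lift 𝔭.height to ℕ using h6 with a ha
    norm_cast at *
    omega
  obtain ⟨k, hk⟩ := Ideal.exists_pow_le_of_le_radical_of_fg hrad
    (maximalIdeal A).fg_of_isNoetherianRing
  refine ModuleCat.ext_eq_zero_of_quotSMulTop (N := ModuleCat.of A (A ⧸ 𝔭)) hx
    (Ideal.Quotient.isSMulRegular_of_notMem hx𝔭)
    (ModuleCat.ext_eq_zero_of_pow_maximalIdeal_le_annihilator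
      (ext_residueField_eq_zero hn (by omega)) _ (k := k) (hk.trans (sup_le ?_ ?_)))
  · intro a ha
    rw [Module.mem_annihilator]
    intro z
    obtain ⟨z, rfl⟩ := Submodule.mkQ_surjective _ z
    obtain ⟨b, rfl⟩ := Submodule.mkQ_surjective _ z
    rw [← map_smul, ← map_smul, Submodule.mkQ_apply 𝔭, (Submodule.Quotient.mk_eq_zero 𝔭).mpr
      (show a • b ∈ 𝔭 from Ideal.mul_mem_right b 𝔭 ha), map_zero]
  · rw [Ideal.span_singleton_le_iff_mem, Module.mem_annihilator]
    intro z
    obtain ⟨z, rfl⟩ := Submodule.mkQ_surjective _ z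
    rw [← map_smul, Submodule.mkQ_apply, Submodule.Quotient.mk_eq_zero]
    exact Submodule.smul_mem_pointwise_smul _ _ _ trivial

/-- If `Extᵈ(A / 𝔭, A)` vanishes, then by Rees' isomorphism `A / (rs)` has no nonzero element killed
by `𝔭`, where `d` is the length of `rs`. -/
theorem mem_ofList_of_forall_mul_mem {rs : List A}
    (hreg : IsWeaklyRegular A rs) {𝔭 : Ideal A} (h𝔭 : Ideal.ofList rs ≤ 𝔭)
    (hExt : ∀ e : Ext (ModuleCat.of A (A ⧸ 𝔭)) (ModuleCat.of A A) rs.length, e = 0) {x : A}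
    (hx : ∀ a ∈ 𝔭, a * x ∈ Ideal.ofList rs) : x ∈ Ideal.ofList rs := by
  obtain ⟨e, he⟩ := ModuleCat.exists_ext_bijective_mk₀_comp rs A hreg
  have h1 : (Ideal.ofList rs • ⊤ : Submodule A A) = Ideal.ofList rs := by
    rw [smul_eq_mul, Ideal.mul_top]
  let f : (A ⧸ 𝔭) →ₗ[A] A ⧸ (Ideal.ofList rs • ⊤ : Submodule A A) :=
    Submodule.liftQ 𝔭 (LinearMap.toSpanSingleton A _ (Submodule.Quotient.mk x)) fun a ha => by
      rw [LinearMap.mem_ker, LinearMap.toSpanSingleton_apply, ← Submodule.Quotient.mk_smul,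
        Submodule.Quotient.mk_eq_zero, h1]
      exact hx a ha
  have h2 : ModuleCat.ofHom f = 0 := by
    refine (he (ModuleCat.of A (A ⧸ 𝔭)) fun r hr z => ?_).1 ((hExt _).trans (hExt _).symm)
    obtain ⟨a, rfl⟩ := Submodule.mkQ_surjective _ z
    rw [← map_smul, Submodule.mkQ_apply, Submodule.Quotient.mk_eq_zero]
    exact Ideal.mul_mem_right _ _ (h𝔭 (Ideal.subset_span hr))
  have h3 : f (Submodule.Quotient.mk (1 : A)) = 0 :=
    LinearMap.congr_fun (congrArg ModuleCat.Hom.hom h2) (Submodule.Quotient.mk (1 : A))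
  have h4 : (Submodule.Quotient.mk ((1 : A) • x) :
    A ⧸ (Ideal.ofList rs • ⊤ : Submodule A A)) = 0 := h3
  rwa [one_smul, Submodule.Quotient.mk_eq_zero, h1] at h4

end CohenMacaulay

section PrimeAvoidance

variable {A : Type u} [CommRing A]

/-- Prime avoidance for the coset `x + I`. -/
theorem Ideal.exists_mem_forall_add_notMem (x : A) (I : Ideal A) (s : Finset (Ideal A)) :
    (∀ 𝔭 ∈ s, 𝔭.IsPrime) → (∀ 𝔭 ∈ s, ¬ Ideal.span {x} ⊔ I ≤ 𝔭) →
      ∃ i ∈ I, ∀ 𝔭 ∈ s, x + i ∉ 𝔭 := by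
  classical
  induction s using Finset.strongInduction with
  | H s ih =>
    intro hp hI
    rcases s.eq_empty_or_nonempty with rfl | hs
    · exact ⟨0, I.zero_mem, by simp⟩
    -- Minimality of `𝔮` keeps the product of the other primes outside `𝔮`.
    obtain ⟨𝔮, h𝔮⟩ := s.exists_minimal hs
    have h𝔮s : 𝔮 ∈ s := h𝔮.1
    have := hp 𝔮 h𝔮s
    obtain ⟨i, hi, his⟩ := ih (s.erase 𝔮) (Finset.erase_ssubset h𝔮s)
      (fun 𝔭 h => hp 𝔭 (Finset.mem_of_mem_erase h)) (fun 𝔭 h => hI 𝔭 (Finset.mem_of_mem_erase h))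
    by_cases hx : x + i ∈ 𝔮
    · -- `x + i ∈ 𝔮` is moved out of `𝔮` by an element of `I` in every other prime of `s`.
      have hI𝔮 : ¬ I ≤ 𝔮 := fun h => hI 𝔮 h𝔮s (sup_le ((Ideal.span_singleton_le_iff_mem _).mpr
        ((𝔮.add_mem_iff_left (h hi)).mp hx)) h)
      have hprod : ¬ I * ∏ 𝔭 ∈ s.erase 𝔮, 𝔭 ≤ 𝔮 := by
        rw [Ideal.IsPrime.mul_le this, Ideal.IsPrime.prod_le this]
        rintro (h | ⟨𝔭, h𝔭, hle⟩)
        · exact hI𝔮 h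
        · obtain ⟨hne, h𝔭s⟩ := Finset.mem_erase.mp h𝔭
          exact hne (le_antisymm hle (h𝔮.2 h𝔭s hle))
      obtain ⟨y, hy, hy𝔮⟩ := SetLike.not_le_iff_exists.mp hprod
      refine ⟨i + y, I.add_mem hi (Ideal.mul_le_inf hy).1, fun 𝔭 h𝔭 => ?_⟩
      rw [← add_assoc]
      by_cases h : 𝔭 = 𝔮
      · exact h ▸ fun h' => hy𝔮 ((𝔮.add_mem_iff_right hx).mp h')
      · have h1 := Finset.mem_erase.mpr ⟨h, h𝔭⟩
        have h2 : y ∈ 𝔭 := (Ideal.prod_le_inf.trans (Finset.inf_le (f := id) h1))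
          (Ideal.mul_le_inf hy).2
        exact fun h' => his 𝔭 h1 ((𝔭.add_mem_iff_left h2).mp h')
    · refine ⟨i, hi, fun 𝔭 h𝔭 => ?_⟩
      by_cases h : 𝔭 = 𝔮
      · exact h ▸ hx
      · exact his 𝔭 (Finset.mem_erase.mpr ⟨h, h𝔭⟩)

end PrimeAvoidance

/-! ### Almost complete intersections in a regular local ring -/

section AlmostCompleteIntersection

open Abelian RingTheory.Sequence

variable {A : Type u} [CommRing A] [IsRegularLocalRing A]

/-- No associated prime of `A / (rs)` contains an ideal of height at least `n - 1` when `rs` has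
fewer than `n - 1` elements, so `x` can be corrected within `I` to an element regular on
`A / (rs)`. -/
theorem IsRegularLocalRing.exists_mem_isSMulRegular_add {n : ℕ} (hn : ringKrullDim A = n)
    {rs : List A} (hrs : IsWeaklyRegular A rs) (hlen : rs.length + 2 ≤ n) (x : A) (I : Ideal A)
    (hht : n ≤ (Ideal.ofList rs ⊔ (Ideal.span {x} ⊔ I)).height + 1) :
    ∃ y ∈ I, IsSMulRegular (A ⧸ (Ideal.ofList rs • ⊤ : Submodule A A)) (x + y) := by
  have h1 : (Ideal.ofList rs • ⊤ : Submodule A A) = Ideal.ofList rs := by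
    rw [smul_eq_mul, Ideal.mul_top]
  have hfin := associatedPrimes.finite A (A ⧸ (Ideal.ofList rs • ⊤ : Submodule A A))
  obtain ⟨y, hy, hy'⟩ := Ideal.exists_mem_forall_add_notMem x I hfin.toFinset
    (fun 𝔭 h𝔭 => ((Set.Finite.mem_toFinset _).mp h𝔭).isPrime) (fun 𝔭 h𝔭 hle => by
      obtain ⟨hprime, z, hz⟩ := (Submodule.isAssociatedPrime_iff).mp
        ((Set.Finite.mem_toFinset _).mp h𝔭)
      obtain ⟨z, rfl⟩ := Submodule.mkQ_surjective _ z
      have hmem (a : A) : a ∈ 𝔭 ↔ a * z ∈ Ideal.ofList rs := by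
        rw [hz, Submodule.mem_colon_singleton, ← map_smul, Submodule.mem_bot, Submodule.mkQ_apply,
          Submodule.Quotient.mk_eq_zero, h1, smul_eq_mul]
      have hrs𝔭 : Ideal.ofList rs ≤ 𝔭 := fun a ha => (hmem a).mpr (Ideal.mul_mem_right _ _ ha)
      have hht' : (n : ℕ∞) ≤ 𝔭.height + 1 :=
        hht.trans (add_le_add_left (Ideal.height_mono (sup_le hrs𝔭 hle)) 1)
      have hz0 := mem_ofList_of_forall_mul_mem hrs hrs𝔭
        (ext_quotient_prime_eq_zero hn hht' hlen) fun a ha => (hmem a).mp ha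
      exact hprime.one_notMem ((hmem 1).mpr (by rwa [one_mul])))
  refine ⟨y, hy, ?_⟩
  by_contra hreg
  have h2 := biUnion_associatedPrimes_eq_compl_regular A
    (A ⧸ (Ideal.ofList rs • ⊤ : Submodule A A))
  have h3 : x + y ∈ {r : A | IsSMulRegular (A ⧸ (Ideal.ofList rs • ⊤ : Submodule A A)) r}ᶜ := hreg
  rw [← h2, Set.mem_iUnion₂] at h3
  obtain ⟨𝔭, h𝔭, hmem⟩ := h3
  exact hy' 𝔭 ((Set.Finite.mem_toFinset _).mpr h𝔭) hmem

/-- An ideal `𝔧` generated by `n = dim A` elements, of image of height at least `n - 1` under a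
surjection onto a regular local ring `A`, has `n` generators the first `n - 1` of which form a
regular sequence on `A`. -/
theorem IsRegularLocalRing.exists_isWeaklyRegular_map_of_le_height {d : ℕ}
    (hn : ringKrullDim A = (d + 1 : ℕ)) {R : Type u} [CommRing R] {φ : R →+* A}
    (hφ : Function.Surjective φ) (fs : List R) (hfs : fs.length = d + 1)
    (hht : (d + 1 : ℕ) ≤ (Ideal.map φ (Ideal.ofList fs)).height + 1) :
    ∃ (rs : List R) (h : R), rs.length = d ∧ Ideal.ofList rs ⊔ Ideal.span {h} = Ideal.ofList fs ∧
      IsWeaklyRegular A (rs.map φ) := by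
  have key (i : ℕ) : i ≤ d → ∃ rs ts : List R, rs.length = i ∧ i + ts.length = d + 1 ∧
      Ideal.ofList rs ⊔ Ideal.ofList ts = Ideal.ofList fs ∧ IsWeaklyRegular A (rs.map φ) := by
    induction i with
    | zero => exact fun _ => ⟨[], fs, rfl, by omega, by simp, .nil _ _⟩
    | succ i ih =>
      intro hi
      obtain ⟨rs, ts, hrs, hts, hJ, hreg⟩ := ih (by omega)
      match ts with
      | [] => simp at hts; omega
      | t :: ts =>
        rw [Ideal.ofList_cons] at hJ
        obtain ⟨y, hy, hyreg⟩ := exists_mem_isSMulRegular_add hn hreg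
          (by simp only [List.length_map]; omega) (φ t) (Ideal.map φ (Ideal.ofList ts)) (by
            rw [← Ideal.map_ofList, ← Set.image_singleton, ← Ideal.map_span, ← Ideal.map_sup,
              ← Ideal.map_sup, hJ]
            exact hht)
        obtain ⟨y, hyt, rfl⟩ := (Ideal.mem_map_iff_of_surjective φ hφ).mp hy
        refine ⟨rs ++ [t + y], ts, by simp [hrs], by simp at hts; omega, ?_, ?_⟩
        · rw [← hJ, Ideal.ofList_append, Ideal.ofList_singleton, sup_assoc]
          congr 1
          refine le_antisymm (sup_le ?_ le_sup_right) (sup_le ?_ le_sup_right) <;>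
            rw [Ideal.span_singleton_le_iff_mem]
          · exact Ideal.add_mem _ (Ideal.mem_sup_left (Ideal.mem_span_singleton_self t))
              (Ideal.mem_sup_right hyt)
          · have h1 := Ideal.sub_mem _ (Ideal.mem_sup_left (T := Ideal.ofList ts)
              (Ideal.mem_span_singleton_self (t + y))) (Ideal.mem_sup_right hyt)
            rwa [add_sub_cancel_right] at h1
        · rw [List.map_append, isWeaklyRegular_append_iff]
          refine ⟨hreg, ?_⟩
          simpa [isWeaklyRegular_cons_iff] using hyreg
  obtain ⟨rs, ts, hrs, hts, hJ, hreg⟩ := key d le_rfl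
  obtain ⟨h, rfl⟩ := List.length_eq_one_iff.mp (show ts.length = 1 by omega)
  exact ⟨rs, h, hrs, by rw [← hJ, Ideal.ofList_singleton], hreg⟩

theorem mem_saturation {A : Type u} [CommRing A] [IsLocalRing A] {J : Ideal A} {x : A} :
    x ∈ saturation J ↔ ∃ k : ℕ, ∀ a ∈ maximalIdeal A ^ k, a * x ∈ J := by
  rw [saturation, Submodule.mem_iSup_of_directed]
  · simp [Submodule.mem_colon, mul_comm]
  · refine Monotone.directed_le fun k l hkl x hx => ?_
    rw [Submodule.mem_colon] at hx ⊢
    exact fun a ha => hx a (Ideal.pow_le_pow_right hkl ha)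

/-- The double colon `((g) : ((g) : h))` is the saturation of `(g, h)`. One inclusion holds because
`Ext^{d+1}(A / (g, h), A)` has finite length, the other because `A / (g)` has depth one. -/
theorem IsRegularLocalRing.mem_doubleColon_iff_mem_saturation {d : ℕ}
    (hn : ringKrullDim A = (d + 1 : ℕ)) {gs : List A} (hgs : IsWeaklyRegular A gs)
    (hlen : gs.length = d) (h : A) {J : Ideal A} (hJ : Ideal.ofList gs ⊔ Ideal.span {h} = J)
    (hJm : J ≤ maximalIdeal A) (x : A) :
    x ∈ doubleColon gs h A ↔ x ∈ saturation J := by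
  have h1 (I : Ideal A) : (I • ⊤ : Submodule A A) = I := by rw [smul_eq_mul, Ideal.mul_top]
  rw [mem_saturation]
  constructor
  · intro hx
    obtain ⟨ψ, -, hψ⟩ := exists_doubleColon_linearMap_ext h hJ A hgs hgs
    obtain ⟨k, hk⟩ := ModuleCat.exists_pow_maximalIdeal_smul_ext_eq_zero (ModuleCat.of A A)
      (gs.length + 1) (fun N _ _ _ e => by
        have hpd := hasProjectiveDimensionLE (d + 1) A hn N
        exact Ext.eq_zero_of_hasProjectiveDimensionLT (X := ModuleCat.of A N) _ (d + 1 + 1)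
          (by omega)) (A ⧸ J)
    refine ⟨k, fun a ha => ?_⟩
    have h2 := (hψ (a • ⟨x, hx⟩)).mp (by rw [map_smul]; exact hk a ha _)
    rwa [h1] at h2
  · rintro ⟨k, hk⟩
    have hdepth (y : A) (hy : ∀ a ∈ maximalIdeal A, a * y ∈ Ideal.ofList gs) :
        y ∈ Ideal.ofList gs :=
      mem_ofList_of_forall_mul_mem hgs ((le_sup_left.trans hJ.le).trans hJm)
        (ext_residueField_eq_zero hn (by omega)) hy
    have hsat (k : ℕ) : ∀ y : A, (∀ a ∈ maximalIdeal A ^ k, a * y ∈ Ideal.ofList gs) →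
        y ∈ Ideal.ofList gs := by
      induction k with
      | zero => exact fun y hy => by simpa using hy 1 (by simp)
      | succ k ih =>
        refine fun y hy => ih y fun a ha => hdepth _ fun b hb => ?_
        rw [← mul_assoc, mul_comm b]
        exact hy _ (by rw [pow_succ]; exact Ideal.mul_mem_mul ha hb)
    rw [mem_doubleColon]
    intro a ha
    rw [h1]
    refine hsat k _ fun b hb => ?_
    have h2 := hk b hb
    rw [← hJ, Submodule.mem_sup] at h2
    obtain ⟨g, hg, w, hw, hgw⟩ := h2
    obtain ⟨c, rfl⟩ := Ideal.mem_span_singleton'.mp hw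
    rw [smul_eq_mul, mul_left_comm, ← hgw, mul_add, mul_left_comm a c h]
    exact Ideal.add_mem _ (Ideal.mul_mem_left _ _ hg) (Ideal.mul_mem_left _ _ ha)

end AlmostCompleteIntersection

/-! ### Kernels and projective dimension for modules flat over a base -/

section FlatExt

open Abelian RingTheory.Sequence

variable {S : Type v} [CommRing S] {R : Type u} [CommRing R] [Algebra S R]

/-- If an `R`-module `X` already carries a compatible `S`-module structure, then this structure is
the one obtained by restriction of scalars. -/
def RestrictScalars.equivOfIsScalarTower (X : Type u) [AddCommGroup X] [Module R X] [Module S X]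
    [IsScalarTower S R X] : RestrictScalars S R X ≃ₗ[S] X :=
  { RestrictScalars.addEquiv S R X with
    map_smul' := fun s x => by
      change RestrictScalars.addEquiv S R X (s • x) = s • RestrictScalars.addEquiv S R X x
      rw [RestrictScalars.addEquiv_map_smul, algebraMap_smul] }

theorem Module.Flat.restrictScalars_iff (X : Type u) [AddCommGroup X] [Module R X] [Module S X]
    [IsScalarTower S R X] : Module.Flat S (RestrictScalars S R X) ↔ Module.Flat S X :=
  Module.Flat.equiv_iff (RestrictScalars.equivOfIsScalarTower X)

variable {X N : Type u} [AddCommGroup X] [Module R X] [Module S X] [IsScalarTower S R X]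
  [AddCommGroup N] [Module R N] [Module S N] [IsScalarTower S R N]

/-- The kernel of a surjection onto an `S`-flat module is pure: it meets `𝔞 X` in `𝔞` times
itself. -/
theorem Module.Flat.mem_map_smul_ker [Module.Flat S N] {f : X →ₗ[R] N}
    (hf : Function.Surjective f) {𝔞 : Ideal S} {x : X} (hx : x ∈ LinearMap.ker f)
    (hx𝔞 : x ∈ (Ideal.map (algebraMap S R) 𝔞 • ⊤ : Submodule R X)) :
    x ∈ Ideal.map (algebraMap S R) 𝔞 • LinearMap.ker f := by
  obtain ⟨k, s, y, hs, rfl⟩ := Submodule.exists_sum_of_mem_map_smul_top hx𝔞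
  have hrel : ∑ i, s i • f (y i) = 0 := by
    rw [LinearMap.mem_ker, map_sum] at hx
    rw [← hx]
    exact Finset.sum_congr rfl fun i _ => (f.map_smul_of_tower _ _).symm
  obtain ⟨l, a, u, hu, ha⟩ := Module.Flat.isTrivialRelation_of_sum_smul_eq_zero hrel
  beta_reduce at hu
  choose w hw using fun j => hf (u j)
  have h1 : ∑ i, s i • y i = ∑ i, s i • (y i - ∑ j, a i j • w j) := by
    simp only [smul_sub, Finset.sum_sub_distrib, Finset.smul_sum, smul_smul]
    rw [eq_comm, sub_eq_self, Finset.sum_comm]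
    simp only [← Finset.sum_smul, ha, zero_smul, Finset.sum_const_zero]
  rw [h1]
  refine Submodule.sum_mem _ fun i _ => ?_
  rw [← _root_.algebraMap_smul R (s i)]
  refine Submodule.smul_mem_smul (Ideal.mem_map_of_mem _ (hs i)) ?_
  rw [LinearMap.mem_ker, map_sub, hu, map_sum, sub_eq_zero]
  exact Finset.sum_congr rfl fun j _ => by rw [f.map_smul_of_tower, hw]

/-- The kernel of a surjection between `S`-flat modules is `S`-flat. -/
theorem Module.Flat.ker [Module.Flat S X] [Module.Flat S N] {f : X →ₗ[R] N}
    (hf : Function.Surjective f) : Module.Flat S (LinearMap.ker f) := by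
  refine Module.Flat.of_forall_isTrivialRelation fun {l s x} hx => ?_
  have hrel : ∑ i, s i • (x i : X) = 0 := by
    have := congrArg Subtype.val hx
    simpa using this
  obtain ⟨m, a, y, hy, ha⟩ := Module.Flat.isTrivialRelation_of_sum_smul_eq_zero hrel
  beta_reduce at hy
  -- The relations `a i` among the `f (y j)` are trivial by flatness of `N`.
  have h0 : Fintype.linearCombination S (fun j => f (y j)) ∘ₗ
      Fintype.linearCombination S a = 0 := by
    refine LinearMap.pi_ext' fun i => LinearMap.ext_ring ?_
    have h1 : f (x i) = 0 := (x i).2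
    rw [hy, map_sum] at h1
    simpa [Fintype.linearCombination_apply_single, Fintype.linearCombination_apply] using h1
  obtain ⟨κ, b, z, hz, hb⟩ := Module.Flat.exists_factorization_of_comp_eq_zero_of_free h0
  choose w hw using fun t => hf (z (Finsupp.single t 1))
  have hzw (v : Fin κ →₀ S) : f (∑ t, v t • w t) = z v := by
    rw [map_sum]
    conv_rhs => rw [← Finsupp.univ_sum_single v, map_sum]
    refine Finset.sum_congr rfl fun t _ => ?_
    rw [f.map_smul_of_tower, hw, ← map_smul, Finsupp.smul_single, smul_eq_mul, mul_one]
  refine ⟨m, a, fun j => ⟨y j - ∑ t, b (Pi.single j 1) t • w t, ?_⟩, fun i => ?_, ha⟩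
  · rw [LinearMap.mem_ker, map_sub, hzw, sub_eq_zero]
    have h1 := LinearMap.congr_fun hz (Pi.single j 1)
    simpa [Fintype.linearCombination_apply_single] using h1
  · refine Subtype.ext ?_
    have h1 : ∑ j, a i j • b (Pi.single j 1) = 0 := by
      have h2 := LinearMap.congr_fun hb (Pi.single i 1)
      simp only [LinearMap.comp_apply, Fintype.linearCombination_apply_single, one_smul,
        LinearMap.zero_apply] at h2
      rw [← h2]
      conv_rhs => rw [pi_eq_sum_univ' (a i), map_sum]
      simp only [map_smul]
    have h3 : ∑ j, a i j • ∑ t, b (Pi.single j 1) t • w t = 0 := by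
      simp only [Finset.smul_sum, smul_smul]
      rw [Finset.sum_comm]
      refine Finset.sum_eq_zero fun t _ => ?_
      have h4 := DFunLike.congr_fun h1 t
      simp only [Finsupp.finsetSum_apply, Finsupp.smul_apply, smul_eq_mul,
        Finsupp.zero_apply] at h4
      rw [← Finset.sum_smul, h4, zero_smul]
    simp only [Submodule.coe_sum, Submodule.coe_smul_of_tower, smul_sub, Finset.sum_sub_distrib]
    rw [h3, sub_zero, hy]

/-- The projective dimension of a finite `R`-module that is flat over `S` is at most that of its
restriction to the special fibre. -/
theorem hasProjectiveDimensionLE_of_flat [IsLocalRing S] [IsLocalRing R] [IsNoetherianRing R]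
    [Module.Flat S R] (hloc : maxExt S R ≤ maximalIdeal R) {n : ℕ} [Module.Finite R N]
    [Module.Flat S N]
    (hpd : HasProjectiveDimensionLE
      (ModuleCat.of (R ⧸ maxExt S R) (N ⧸ (maxExt S R • ⊤ : Submodule R N))) n) :
    HasProjectiveDimensionLE (ModuleCat.of R N) n := by
  refine hasProjectiveDimensionLE_of_quotient hloc
    (fun N _ _ => Module.Flat S (RestrictScalars S R N)) (fun N _ _ hN m f hf => ?_) n N
    ((Module.Flat.restrictScalars_iff N).mpr ‹_›) hpd
  let : Module S N := Module.compHom N (algebraMap S R)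
  have : IsScalarTower S R N := .of_algebraMap_smul fun _ _ => rfl
  have : Module.Flat S N := (Module.Flat.restrictScalars_iff N).mp hN
  have : Module.Flat S (Fin m → R) :=
    .of_linearEquiv ((Finsupp.linearEquivFunOnFinite S R (Fin m)).symm.trans
      (finsuppLEquivDirectSum S R (Fin m)))
  exact ⟨(Module.Flat.restrictScalars_iff (LinearMap.ker f)).mpr (Module.Flat.ker hf),
    fun y hy hy' => Module.Flat.mem_map_smul_ker hf hy hy'⟩

end FlatExt

/-! ### Top-degree Ext and flatness -/

section ExtFunctoriality

open Abelian

variable {R : Type u} [CommRing R]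

/-- The covariant functoriality of `Extⁿ(M, -)`, bilinear in the map and in the class. -/
noncomputable def ModuleCat.extMap (M : ModuleCat.{u} R) (n : ℕ) {Y Z : Type u} [AddCommGroup Y]
    [Module R Y] [AddCommGroup Z] [Module R Z] :
    (Y →ₗ[R] Z) →ₗ[R] Ext M (of R Y) n →ₗ[R] Ext M (of R Z) n :=
  LinearMap.mk₂ R (fun f e => e.comp (Ext.mk₀ (ofHom f)) (add_zero n))
    (fun f g e => by rw [ofHom_add, Ext.mk₀_add, Ext.comp_add])
    (fun r f e => by
      rw [show ofHom (r • f) = r • ofHom f from rfl, Ext.mk₀_smul, Ext.comp_smul])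
    (fun f e e' => by rw [Ext.add_comp])
    (fun r f e => by rw [Ext.smul_comp])

variable (M : ModuleCat.{u} R) (n : ℕ) {Y Z W : Type u} [AddCommGroup Y] [Module R Y]
  [AddCommGroup Z] [Module R Z] [AddCommGroup W] [Module R W]

theorem ModuleCat.extMap_apply (f : Y →ₗ[R] Z) (e : Ext M (of R Y) n) :
    extMap M n f e = e.comp (Ext.mk₀ (ofHom f)) (add_zero n) :=
  rfl

theorem ModuleCat.extMap_comp_apply (f : Y →ₗ[R] Z) (g : Z →ₗ[R] W) (e : Ext M (of R Y) n) :
    extMap M n (g ∘ₗ f) e = extMap M n g (extMap M n f e) := by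
  rw [extMap_apply, extMap_apply, extMap_apply, Ext.comp_assoc_of_third_deg_zero, Ext.mk₀_comp_mk₀]
  rfl

theorem ModuleCat.extMap_id_apply (e : Ext M (of R Y) n) :
    extMap M n (LinearMap.id : Y →ₗ[R] Y) e = e :=
  Ext.comp_mk₀_id e

/-- `Extⁿ(M, -)` is right exact when `M` has projective dimension at most `n`. -/
theorem ModuleCat.extMap_surjective [HasProjectiveDimensionLE M n] {g : Y →ₗ[R] Z}
    (hg : Function.Surjective g) : Function.Surjective (extMap M n g) := by
  intro e
  let T : ShortComplex (ModuleCat.{u} R) := ModuleCat.shortComplexOfCompEqZero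
    (LinearMap.ker g).subtype g (LinearMap.exact_subtype_ker_map g).linearMap_comp_eq_zero
  have hT : T.ShortExact := ModuleCat.shortComplex_shortExact T
    (LinearMap.exact_subtype_ker_map g) (Submodule.subtype_injective _) hg
  exact Ext.covariant_sequence_exact₃ M hT e (n₁ := n + 1) rfl
    (Ext.eq_zero_of_hasProjectiveDimensionLT _ (n + 1) le_rfl)

theorem ModuleCat.extMap_exact [HasProjectiveDimensionLE M n] {f : Y →ₗ[R] Z} {g : Z →ₗ[R] W}
    (hg : Function.Surjective g) (hfg : Function.Exact f g) :
    Function.Exact (extMap M n f) (extMap M n g) := by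
  intro e
  constructor
  · intro he
    let T : ShortComplex (ModuleCat.{u} R) := ModuleCat.shortComplexOfCompEqZero
      (LinearMap.ker g).subtype g (LinearMap.exact_subtype_ker_map g).linearMap_comp_eq_zero
    have hT : T.ShortExact := ModuleCat.shortComplex_shortExact T
      (LinearMap.exact_subtype_ker_map g) (Submodule.subtype_injective _) hg
    obtain ⟨e₁, he₁⟩ := Ext.covariant_sequence_exact₂ M hT e he
    let f' : Y →ₗ[R] LinearMap.ker g := f.codRestrict _ fun y => hfg.apply_apply_eq_zero y
    have hf' : Function.Surjective f' := fun z => by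
      obtain ⟨y, hy⟩ := (hfg z).mp z.2
      exact ⟨y, Subtype.ext hy⟩
    obtain ⟨e₀, rfl⟩ := extMap_surjective M n hf' e₁
    refine ⟨e₀, ?_⟩
    have h1 : f = (LinearMap.ker g).subtype ∘ₗ f' := rfl
    rw [h1, extMap_comp_apply]
    exact he₁
  · rintro ⟨e, rfl⟩
    rw [← extMap_comp_apply, hfg.linearMap_comp_eq_zero, map_zero, LinearMap.zero_apply]

/-- Part of the long exact sequence of `0 → Y' → Y → Y / Y' → 0`. -/
theorem ModuleCat.extMap_subtype_injective {d : ℕ} (Y' : Submodule R Y)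
    (h : Function.Surjective (extMap M d Y'.mkQ)) :
    Function.Injective (extMap M (d + 1) Y'.subtype) := by
  rw [injective_iff_map_eq_zero]
  intro e he
  let T : ShortComplex (ModuleCat.{u} R) := ModuleCat.shortComplexOfCompEqZero Y'.subtype Y'.mkQ
    (LinearMap.exact_subtype_mkQ Y').linearMap_comp_eq_zero
  have hT : T.ShortExact := ModuleCat.shortComplex_shortExact T (LinearMap.exact_subtype_mkQ Y')
    (Submodule.subtype_injective _) (Submodule.mkQ_surjective _)
  obtain ⟨e₃, rfl⟩ := Ext.covariant_sequence_exact₁ M hT e he rfl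
  obtain ⟨e₂, rfl⟩ := h e₃
  have h1 : (Ext.mk₀ T.g).comp hT.extClass (zero_add 1) = 0 := hT.comp_extClass
  have h2 (e₂ : Ext M T.X₂ d) :
      (e₂.comp (Ext.mk₀ T.g) (add_zero d)).comp hT.extClass rfl = 0 := by
    rw [Ext.comp_assoc_of_second_deg_zero, h1, Ext.comp_zero]
  exact h2 e₂

theorem ModuleCat.exists_extMap_proj_eq {m : ℕ} (q : Fin m → Ext M (of R Y) n) :
    ∃ e : Ext M (of R (Fin m → Y)) n, ∀ i, extMap M n (LinearMap.proj i) e = q i := by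
  classical
  refine ⟨∑ i, extMap M n (LinearMap.single R (fun _ => Y) i) (q i), fun i => ?_⟩
  rw [map_sum, Finset.sum_eq_single i]
  · rw [← extMap_comp_apply, LinearMap.proj_comp_single_same, extMap_id_apply]
  · intro j _ hij
    rw [← extMap_comp_apply, LinearMap.proj_comp_single_ne _ _ _ _ hij.symm, map_zero,
      LinearMap.zero_apply]
  · simp

/-- A linear form `R^m → R` acts on `Extⁿ(M, R^m) = Extⁿ(M, R)^m` through its coefficients. -/
theorem ModuleCat.extMap_linearCombination {m : ℕ} (b : Fin m → R)
    (e : Ext M (of R (Fin m → R)) n) :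
    extMap M n (Fintype.linearCombination R b) e =
      ∑ i, b i • extMap M n (LinearMap.proj i) e := by
  have h1 : Fintype.linearCombination R b =
      ∑ i, b i • LinearMap.proj (R := R) (φ := fun _ => R) i := by
    refine LinearMap.ext fun v => ?_
    simp [Fintype.linearCombination_apply, mul_comm]
  rw [h1, map_sum, LinearMap.sum_apply]
  exact Finset.sum_congr rfl fun i _ => by rw [map_smul, LinearMap.smul_apply]

/-- Base change `Extⁿ(M, R) / 𝔟 Extⁿ(M, R) ≃ Extⁿ(M, R / 𝔟)` in the top degree `n`, in the form of
the kernel of the surjection `Extⁿ(M, R) → Extⁿ(M, R / 𝔟)`. -/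
theorem ModuleCat.ker_extMap_mkQ [HasProjectiveDimensionLE M n] {𝔟 : Ideal R} (h𝔟 : 𝔟.FG) :
    LinearMap.ker (extMap M n 𝔟.mkQ) = 𝔟 • ⊤ := by
  obtain ⟨m, b, hb⟩ := Submodule.fg_iff_exists_fin_generating_family.mp h𝔟
  have hex : Function.Exact (Fintype.linearCombination R b) 𝔟.mkQ := by
    intro x
    rw [Submodule.mkQ_apply, Submodule.Quotient.mk_eq_zero, ← hb,
      ← Fintype.range_linearCombination R, LinearMap.mem_range]
    rfl
  refine le_antisymm (fun e he => ?_) (Submodule.smul_le.mpr fun r hr e _ => ?_)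
  · obtain ⟨e, rfl⟩ := (extMap_exact M n (Submodule.mkQ_surjective 𝔟) hex e).mp he
    rw [extMap_linearCombination]
    exact Submodule.sum_mem _ fun i _ => Submodule.smul_mem_smul
      (hb ▸ Submodule.subset_span (Set.mem_range_self i)) trivial
  · rw [LinearMap.mem_ker, map_smul, ← LinearMap.smul_apply, ← map_smul]
    have h1 : r • 𝔟.mkQ = 0 := by
      refine LinearMap.ext fun x => ?_
      rw [LinearMap.smul_apply, ← map_smul, Submodule.mkQ_apply, LinearMap.zero_apply,
        Submodule.Quotient.mk_eq_zero]
      exact Ideal.mul_mem_right _ _ hr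
    rw [h1, map_zero, LinearMap.zero_apply]

end ExtFunctoriality

section FlatExt

open Abelian RingTheory.Sequence

variable {S : Type v} [CommRing S] [IsNoetherianRing S] {R : Type u} [CommRing R] [Algebra S R]
  [Module.Flat S R]

/-- By flatness of `R`, the syzygies over `R` of elements of `S` are generated by syzygies
over `S`. -/
theorem Module.Flat.exists_exact_linearCombination_algebraMap {m : ℕ} (s : Fin m → S) :
    ∃ (κ : ℕ) (k : Fin κ → Fin m → S), (∀ j, ∑ i, s i * k j i = 0) ∧
      Function.Exact (Fintype.linearCombination R fun j i => algebraMap S R (k j i))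
        (Fintype.linearCombination R fun i => algebraMap S R (s i)) := by
  obtain ⟨κ, k, hk⟩ := Submodule.fg_iff_exists_fin_generating_family.mp
    (IsNoetherian.noetherian (LinearMap.ker (Fintype.linearCombination S s)))
  have hk0 (j : Fin κ) : ∑ i, s i * k j i = 0 := by
    have h1 : k j ∈ LinearMap.ker (Fintype.linearCombination S s) :=
      hk ▸ Submodule.subset_span (Set.mem_range_self j)
    simpa [Fintype.linearCombination_apply, mul_comm] using h1
  refine ⟨κ, k, hk0, fun r => ⟨fun hr => ?_, ?_⟩⟩
  · have hrel : ∑ i, s i • r i = 0 := by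
      rw [← hr, Fintype.linearCombination_apply]
      exact Finset.sum_congr rfl fun i _ => by rw [Algebra.smul_def, smul_eq_mul, mul_comm]
    obtain ⟨l, a, y, hy, ha⟩ :=
      Module.Flat.isTrivialRelation_of_sum_smul_eq_zero (R := S) (M := R) hrel
    have hspan (v : Fin m → S) (hv : v ∈ Submodule.span S (Set.range k)) :
        (fun i => algebraMap S R (v i)) ∈ LinearMap.range
          (Fintype.linearCombination R fun j i => algebraMap S R (k j i)) := by
      induction hv using Submodule.span_induction with
      | mem v hv =>
        obtain ⟨j, rfl⟩ := hv
        exact ⟨Pi.single j 1, by rw [Fintype.linearCombination_apply_single, one_smul]⟩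
      | zero => exact ⟨0, (map_zero _).trans (funext fun i => (map_zero _).symm)⟩
      | add v w _ _ hv hw =>
        simp only [Pi.add_apply, map_add]
        exact Submodule.add_mem _ hv hw
      | smul c v _ hv =>
        simp only [Pi.smul_apply, smul_eq_mul, map_mul]
        exact Submodule.smul_mem _ (algebraMap S R c) hv
    have h1 : r = ∑ t, y t • fun i => algebraMap S R (a i t) := by
      funext i
      rw [hy, Finset.sum_apply]
      exact Finset.sum_congr rfl fun t _ => by
        rw [Algebra.smul_def, mul_comm, Pi.smul_apply, smul_eq_mul]
    have h2 : r ∈ LinearMap.range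
        (Fintype.linearCombination R fun j i => algebraMap S R (k j i)) := by
      rw [h1]
      refine Submodule.sum_mem _ fun t _ => Submodule.smul_mem _ _ (hspan (fun i => a i t) ?_)
      rw [hk, LinearMap.mem_ker, Fintype.linearCombination_apply, ← ha t]
      exact Finset.sum_congr rfl fun i _ => by rw [smul_eq_mul, mul_comm]
    exact h2
  · rintro ⟨c, rfl⟩
    rw [Fintype.linearCombination_apply R _ c, map_sum]
    refine Finset.sum_eq_zero fun j _ => ?_
    rw [map_smul, Fintype.linearCombination_apply]
    simp only [smul_eq_mul, ← map_mul, ← map_sum]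
    simp only [mul_comm (k j _), hk0, map_zero, mul_zero]

/-- If `M` has projective dimension at most `n`, so that `Extⁿ(M, -)` is right exact, then
`Extⁿ(M, R)` is flat over `S` as soon as `Extⁿ(M, 𝔞R) → Extⁿ(M, R)` is injective for every ideal `𝔞`
of `S`: presenting `𝔞R` by the syzygies of generators of `𝔞` verifies the equational criterion. -/
theorem ModuleCat.flat_ext_of_injective (M : ModuleCat.{u} R) (n : ℕ)
    [HasProjectiveDimensionLE M n]
    (hinj : ∀ 𝔞 : Ideal S, Function.Injective
      (extMap M n (Ideal.map (algebraMap S R) 𝔞).subtype)) :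
    Module.Flat S (RestrictScalars S R (Ext M (of R R) n)) := by
  let : Module S (Ext M (of R R) n) := Module.compHom _ (algebraMap S R)
  have : IsScalarTower S R (Ext M (of R R) n) := .of_algebraMap_smul fun _ _ => rfl
  rw [Module.Flat.restrictScalars_iff]
  refine Module.Flat.of_forall_isTrivialRelation fun {m s q} hq => ?_
  obtain ⟨κ, k, hk, hex⟩ := Module.Flat.exists_exact_linearCombination_algebraMap (R := R) s
  obtain ⟨e, he⟩ := exists_extMap_proj_eq M n q
  let φ := Fintype.linearCombination R fun i => algebraMap S R (s i)
  have hrange : LinearMap.range φ = Ideal.map (algebraMap S R) (Ideal.span (Set.range s)) := by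
    rw [Fintype.range_linearCombination, Ideal.map_span, ← Set.range_comp]
    rfl
  let φ' : (Fin m → R) →ₗ[R] Ideal.map (algebraMap S R) (Ideal.span (Set.range s)) :=
    φ.codRestrict _ fun v => hrange ▸ LinearMap.mem_range_self φ v
  have hφ' : Function.Surjective φ' := by
    rintro ⟨y, hy⟩
    rw [← hrange] at hy
    obtain ⟨v, rfl⟩ := hy
    exact ⟨v, rfl⟩
  have hex' : Function.Exact
      (Fintype.linearCombination R fun j i => algebraMap S R (k j i)) φ' := fun v =>
    (Subtype.ext_iff.trans Iff.rfl).trans (hex v)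
  have h0 : extMap M n φ' e = 0 := by
    refine hinj _ ?_
    rw [map_zero, ← extMap_comp_apply]
    change extMap M n φ e = 0
    rw [extMap_linearCombination, ← hq]
    exact Finset.sum_congr rfl fun i _ => by rw [he, algebraMap_smul]
  obtain ⟨y, rfl⟩ := (extMap_exact M n hφ' hex' e).mp h0
  refine ⟨κ, fun i j => k j i, fun j => extMap M n (LinearMap.proj j) y, fun i => ?_, hk⟩
  have h1 : LinearMap.proj i ∘ₗ (Fintype.linearCombination R fun j i => algebraMap S R (k j i)) =
      Fintype.linearCombination R fun j => algebraMap S R (k j i) := by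
    refine LinearMap.ext fun v => ?_
    simp [Fintype.linearCombination_apply]
  rw [← he, ← extMap_comp_apply, h1, extMap_linearCombination]
  exact Finset.sum_congr rfl fun j _ => algebraMap_smul _ _ _

end FlatExt

/-! ### Ext of a relative almost complete intersection -/

section RelativeAlmostCompleteIntersection

open Abelian RingTheory.Sequence

theorem Ideal.Quotient.mk_mem_smul_top_iff {R : Type u} [CommRing R] {𝔤 𝔟 : Ideal R} {x : R} :
    (Ideal.Quotient.mk 𝔟 x) ∈ (𝔤 • ⊤ : Submodule R (R ⧸ 𝔟)) ↔ x ∈ 𝔤 ⊔ 𝔟 := by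
  rw [← Ideal.Quotient.algebraMap_eq, ← Ideal.mem_quotient_iff_mem_sup, Ideal.smul_top_eq_map,
    Submodule.restrictScalars_mem, Ideal.Quotient.algebraMap_eq]

variable {S : Type v} [CommRing S] {R : Type u} [CommRing R] [Algebra S R]

/-- Flatness of `R / (rs, h)` over `S` lifts relations `y h ∈ (rs)` modulo `𝔞 R` to relations
in `R`. -/
theorem Module.Flat.exists_mul_sub_mem_ofList {rs : List R} {h : R} {𝔧 : Ideal R}
    (h𝔧 : Ideal.ofList rs ⊔ Ideal.span {h} = 𝔧) [Module.Flat S (R ⧸ 𝔧)] {𝔞 : Ideal S} {y : R}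
    (hy : y * h ∈ Ideal.ofList rs ⊔ Ideal.map (algebraMap S R) 𝔞) :
    ∃ c ∈ Ideal.map (algebraMap S R) 𝔞, (y - c) * h ∈ Ideal.ofList rs := by
  obtain ⟨g, hg, b, hb, hgb⟩ := Submodule.mem_sup.mp hy
  have hb𝔧 : b ∈ 𝔧 := by
    rw [← h𝔧, ← sub_eq_of_eq_add' hgb.symm]
    exact Ideal.sub_mem _ (Ideal.mem_sup_right (Ideal.mul_mem_left _ _
      (Ideal.mem_span_singleton_self h))) (Ideal.mem_sup_left hg)
  have hb2 := Module.Flat.mem_map_smul_ker (S := S) (f := 𝔧.mkQ) (Submodule.mkQ_surjective 𝔧)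
    (𝔞 := 𝔞) (x := b) (by rwa [Submodule.ker_mkQ]) (by rwa [smul_eq_mul, Ideal.mul_top])
  rw [Submodule.ker_mkQ, ← h𝔧, smul_eq_mul, Ideal.mul_sup, Submodule.mem_sup] at hb2
  obtain ⟨g', hg', w, hw, hgw⟩ := hb2
  obtain ⟨c, hc, rfl⟩ := Ideal.mem_mul_span_singleton.mp hw
  refine ⟨c, hc, ?_⟩
  rw [sub_mul, ← hgb, ← hgw, ← add_assoc, add_sub_cancel_right]
  exact Ideal.add_mem _ hg (Ideal.mul_le_inf hg').2

/-- The double colon of the special fibre `P` as an `R`-module agrees with that of `P` as a ring,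
because every relation `b h ∈ (rs)P` with `b ∈ P` lifts to `R`. -/
theorem Module.Flat.mem_doubleColon_specialFibre_iff [IsLocalRing S] {rs : List R} {h : R}
    {𝔧 : Ideal R} (h𝔧 : Ideal.ofList rs ⊔ Ideal.span {h} = 𝔧) [Module.Flat S (R ⧸ 𝔧)]
    {y : SpecialFibre S R} :
    y ∈ doubleColon rs h (SpecialFibre S R) ↔
      y ∈ doubleColon (rs.map (Ideal.Quotient.mk (maxExt S R))) (Ideal.Quotient.mk (maxExt S R) h)
        (SpecialFibre S R) := by
  obtain ⟨y, rfl⟩ := Ideal.Quotient.mk_surjective y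
  have hmem (a : R) : Ideal.Quotient.mk (maxExt S R) a ∈
      Ideal.ofList (rs.map (Ideal.Quotient.mk (maxExt S R))) ↔
        a ∈ Ideal.ofList rs ⊔ maxExt S R := by
    rw [← Ideal.map_ofList, Ideal.mem_quotient_iff_mem_sup]
  have hR (a : R) : a • Ideal.Quotient.mk (maxExt S R) y ∈
      (Ideal.ofList rs • ⊤ : Submodule R (SpecialFibre S R)) ↔
      a * y ∈ Ideal.ofList rs ⊔ maxExt S R := Ideal.Quotient.mk_mem_smul_top_iff
  have hP (a : R) : Ideal.Quotient.mk (maxExt S R) a • Ideal.Quotient.mk (maxExt S R) y ∈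
      (Ideal.ofList (rs.map (Ideal.Quotient.mk (maxExt S R))) • ⊤ :
        Submodule (SpecialFibre S R) (SpecialFibre S R)) ↔
      a * y ∈ Ideal.ofList rs ⊔ maxExt S R := by
    rw [smul_eq_mul, smul_eq_mul, Ideal.mul_top, ← map_mul, hmem]
  simp only [mem_doubleColon, Ideal.Quotient.mk_surjective.forall, hR, hP, ← map_mul, hmem]
  refine ⟨fun hy a ha => ?_, fun hy a ha => hy a (Ideal.mem_sup_left ha)⟩
  obtain ⟨c, hc, hac⟩ := exists_mul_sub_mem_ofList h𝔧 ha
  have h1 := Ideal.add_mem _ (hy _ hac)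
    (Ideal.mem_sup_right (S := Ideal.ofList rs) (Ideal.mul_mem_right y _ hc))
  rwa [sub_mul, sub_add_cancel] at h1

variable [IsLocalRing S] [IsNoetherianRing S] [IsLocalRing R] [IsNoetherianRing R]
  [Module.Flat S R]

theorem Module.Flat.isWeaklyRegular_quotient_map (hloc : maxExt S R ≤ maximalIdeal R) {rs : List R}
    (hrs : IsWeaklyRegular (SpecialFibre S R) rs) (𝔞 : Ideal S) :
    IsWeaklyRegular (R ⧸ Ideal.map (algebraMap S R) 𝔞) rs := by
  have h1 (𝔞 : Ideal S) : (Ideal.map (algebraMap S R) 𝔞 • ⊤ : Submodule R R) =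
      Ideal.map (algebraMap S R) 𝔞 := by rw [smul_eq_mul, Ideal.mul_top]
  refine ((Submodule.quotEquivOfEq _ _ (h1 𝔞)).isWeaklyRegular_congr rs).mp
    (isWeaklyRegular_quotient hloc 𝔞 rs R ?_)
  exact ((Submodule.quotEquivOfEq _ _ (h1 _)).isWeaklyRegular_congr rs).mpr hrs

/-- The case `𝔞 = ⊥`: a sequence regular on the special fibre is regular on `R`. -/
theorem Module.Flat.isWeaklyRegular_self (hloc : maxExt S R ≤ maximalIdeal R) {rs : List R}
    (hrs : IsWeaklyRegular (SpecialFibre S R) rs) : IsWeaklyRegular R rs :=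
  ((Submodule.quotEquivOfEqBot (Ideal.map (algebraMap S R) ⊥) Ideal.map_bot).isWeaklyRegular_congr
    rs).mp (isWeaklyRegular_quotient_map hloc hrs ⊥)

/-- Under Rees' isomorphism, surjectivity of `Extᵈ(R / 𝔧, R) → Extᵈ(R / 𝔧, R / 𝔞R)` becomes the
lifting of relations. -/
theorem ModuleCat.extMap_mkQ_surjective_of_flat (hloc : maxExt S R ≤ maximalIdeal R) {rs : List R}
    (hrs : IsWeaklyRegular (SpecialFibre S R) rs) {h : R} {𝔧 : Ideal R}
    (h𝔧 : Ideal.ofList rs ⊔ Ideal.span {h} = 𝔧) [Module.Flat S (R ⧸ 𝔧)] (𝔞 : Ideal S) :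
    Function.Surjective
      (extMap (of R (R ⧸ 𝔧)) rs.length (Ideal.map (algebraMap S R) 𝔞).mkQ) := by
  have hrs𝔧 : ∀ r ∈ rs, r ∈ 𝔧 := fun r hr => h𝔧 ▸ Ideal.mem_sup_left (Ideal.subset_span hr)
  refine exists_ext_comp_mk₀_eq rs (fun r hr x => ?_) R _ _
    (Module.Flat.isWeaklyRegular_self hloc hrs)
    (Module.Flat.isWeaklyRegular_quotient_map hloc hrs 𝔞) fun f => ?_
  · obtain ⟨a, rfl⟩ := Submodule.mkQ_surjective _ x
    rw [← map_smul, Submodule.mkQ_apply, Submodule.Quotient.mk_eq_zero]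
    exact Ideal.mul_mem_right _ _ (hrs𝔧 r hr)
  · -- `f` is given by the class of some `y` with `y h ∈ (rs) + 𝔞R`; the lift is given by `y - c`.
    obtain ⟨y, hy⟩ := Submodule.mkQ_surjective _ (f (Submodule.Quotient.mk (1 : R)))
    obtain ⟨y, rfl⟩ := Ideal.Quotient.mk_surjective y
    have h1 : (Submodule.Quotient.mk h : R ⧸ 𝔧) = h • Submodule.Quotient.mk (1 : R) := by
      rw [← Submodule.Quotient.mk_smul, smul_eq_mul, mul_one]
    have h2 : f (h • Submodule.Quotient.mk (1 : R)) = 0 := by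
      rw [← h1, (Submodule.Quotient.mk_eq_zero 𝔧).mpr
        (h𝔧 ▸ Ideal.mem_sup_right (Ideal.mem_span_singleton_self h)), map_zero]
    rw [map_smul, ← hy, ← map_smul, Submodule.mkQ_apply, Submodule.Quotient.mk_eq_zero] at h2
    have h3 : Ideal.Quotient.mk (Ideal.map (algebraMap S R) 𝔞) (y * h) ∈
        (Ideal.ofList rs • ⊤ : Submodule R (R ⧸ Ideal.map (algebraMap S R) 𝔞)) := by
      rw [mul_comm]
      exact h2
    obtain ⟨c, hc, hyc⟩ := Module.Flat.exists_mul_sub_mem_ofList h𝔧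
      (Ideal.Quotient.mk_mem_smul_top_iff.mp h3)
    have h4 (a : R) : a ∈ LinearMap.ker (LinearMap.toSpanSingleton R
        (R ⧸ (Ideal.ofList rs • ⊤ : Submodule R R)) (Submodule.Quotient.mk (y - c))) ↔
        a * (y - c) ∈ Ideal.ofList rs := by
      rw [LinearMap.mem_ker, LinearMap.toSpanSingleton_apply, ← Submodule.Quotient.mk_smul,
        Submodule.Quotient.mk_eq_zero, smul_eq_mul, smul_eq_mul, Ideal.mul_top]
    let g : (R ⧸ 𝔧) →ₗ[R] R ⧸ (Ideal.ofList rs • ⊤ : Submodule R R) := Submodule.liftQ 𝔧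
      (LinearMap.toSpanSingleton R _ (Submodule.Quotient.mk (y - c))) <| by
        rw [← h𝔧]
        refine sup_le (fun a ha => (h4 a).mpr (Ideal.mul_mem_right _ _ ha)) ?_
        rw [Ideal.span_singleton_le_iff_mem, h4, mul_comm]
        exact hyc
    have hg : g (Submodule.Quotient.mk (1 : R)) = Submodule.Quotient.mk (y - c) :=
      one_smul R (Submodule.Quotient.mk (p := (Ideal.ofList rs • ⊤ : Submodule R R)) (y - c))
    refine ⟨g, LinearMap.ext fun z => ?_⟩
    obtain ⟨a, rfl⟩ := Submodule.mkQ_surjective _ z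
    have h5 : (Submodule.Quotient.mk a : R ⧸ 𝔧) = a • Submodule.Quotient.mk (1 : R) := by
      rw [← Submodule.Quotient.mk_smul, smul_eq_mul, mul_one]
    have h6 : Ideal.Quotient.mk (Ideal.map (algebraMap S R) 𝔞) (y - c) =
        Ideal.Quotient.mk _ y := by
      rw [map_sub, Ideal.Quotient.eq_zero_iff_mem.mpr hc, sub_zero]
    rw [Submodule.mkQ_apply, h5, map_smul, map_smul, ← hy, ← h6, LinearMap.comp_apply, hg]
    rfl

/-- `Ext^{d+1}(R / 𝔧, P)` for the special fibre `P` is the quotient of the saturation of `𝔧 P` by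
`𝔧 P`. -/
theorem IsRegularLocalRing.nonempty_ext_specialFibre_equiv [IsRegularLocalRing (SpecialFibre S R)]
    (hloc : maxExt S R ≤ maximalIdeal R) {d : ℕ}
    (hdim : ringKrullDim (SpecialFibre S R) = (d + 1 : ℕ)) {rs : List R} (hlen : rs.length = d)
    (hrs : IsWeaklyRegular (SpecialFibre S R) rs) {h : R} {𝔧 : Ideal R}
    (h𝔧 : Ideal.ofList rs ⊔ Ideal.span {h} = 𝔧) [Module.Flat S (R ⧸ 𝔧)]
    {J : Ideal (SpecialFibre S R)}
    (hJ : Ideal.map (Ideal.Quotient.mk (maxExt S R)) 𝔧 = J)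
    (hJm : J ≤ maximalIdeal (SpecialFibre S R)) :
    Nonempty (Ext (ModuleCat.of R (R ⧸ 𝔧)) (ModuleCat.of R (SpecialFibre S R)) (d + 1) ≃ₗ[R]
      SaturationQuotient J) := by
  subst hlen
  obtain ⟨ψ, hψ, hψ0⟩ := exists_doubleColon_linearMap_ext h h𝔧 (SpecialFibre S R)
    (Module.Flat.isWeaklyRegular_self hloc hrs) hrs
  have hgJ : Ideal.ofList (rs.map (Ideal.Quotient.mk (maxExt S R))) ⊔
      Ideal.span {Ideal.Quotient.mk (maxExt S R) h} = J := by
    rw [← hJ, ← h𝔧, Ideal.map_sup, Ideal.map_ofList, Ideal.map_span, Set.image_singleton]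
  have hmem (y : SpecialFibre S R) :
      y ∈ doubleColon rs h (SpecialFibre S R) ↔ y ∈ saturation J :=
    (Module.Flat.mem_doubleColon_specialFibre_iff h𝔧).trans
      (mem_doubleColon_iff_mem_saturation hdim
        ((isWeaklyRegular_map_algebraMap_iff (SpecialFibre S R) (SpecialFibre S R) rs).mpr hrs)
        (List.length_map _) _ hgJ hJm y)
  let ι : saturation J →ₗ[R] doubleColon rs h (SpecialFibre S R) :=
    { toFun y := ⟨y, (hmem y).mpr y.2⟩
      map_add' _ _ := rfl
      map_smul' _ _ := rfl }
  have hι : Function.Surjective ι := fun y => ⟨⟨y, (hmem y).mp y.2⟩, rfl⟩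
  have hker : LinearMap.ker (ψ ∘ₗ ι) =
      (Submodule.submoduleOf J (saturation J)).restrictScalars R := by
    ext y
    rw [LinearMap.mem_ker, LinearMap.comp_apply, hψ0, Ideal.smul_top_eq_map,
      Submodule.restrictScalars_mem, Ideal.Quotient.algebraMap_eq, hJ]
    rfl
  exact ⟨(((Submodule.Quotient.restrictScalarsEquiv R (Submodule.submoduleOf J (saturation J))).symm
    ≪≫ₗ Submodule.quotEquivOfEq _ _ hker.symm) ≪≫ₗ
      (ψ ∘ₗ ι).quotKerEquivOfSurjective (hψ.comp hι)).symm⟩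

end RelativeAlmostCompleteIntersection

/-! ### Finiteness over a Weierstrass algebra -/

section WeierstrassAlgebra

theorem Module.Flat.free_restrictScalars {S : Type v} [CommRing S] [IsLocalRing S] {R : Type u}
    [CommRing R] [Algebra S R] (Q : Type u) [AddCommGroup Q] [Module R Q]
    [hfin : Module.Finite S (RestrictScalars S R Q)]
    [hflat : Module.Flat S (RestrictScalars S R Q)] :
    Module.Free S (RestrictScalars S R Q) := by
  let : Module S Q := Module.compHom Q (algebraMap S R)
  have : IsScalarTower S R Q := .of_algebraMap_smul fun _ _ => rfl
  have : Module.Flat S Q := (Module.Flat.restrictScalars_iff Q).mp hflat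
  have : Module.Finite S Q := hfin.equiv (RestrictScalars.equivOfIsScalarTower Q)
  have : Module.Free S Q := Module.free_of_flat_of_isLocalRing
  exact Module.Free.of_equiv (RestrictScalars.equivOfIsScalarTower (S := S) (R := R) Q).symm

variable {S : Type v} [CommRing S] {R : Type u} [CommRing R] [IsLocalRing R] [IsNoetherianRing R]
  [Algebra S R]

/-- A finite `R`-module of finite length is finite over `S` if the residue field of `R` is. -/
theorem Module.finite_of_pow_maximalIdeal_le_annihilator [Module.Finite S (ResidueField R)]
    {k : ℕ} (N : Type u) [AddCommGroup N] [Module R N] [hN : Module.Finite R N] :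
    ∀ [Module S N] [IsScalarTower S R N], maximalIdeal R ^ k ≤ Module.annihilator R N →
      Module.Finite S N := by
  induction hN using IsNoetherianRing.induction_on_isQuotientEquivQuotientPrime R with
  | subsingleton N => exact fun _ => inferInstance
  | quotient N 𝔭 ι =>
    intro _ _ hk
    have := 𝔭.2
    have h𝔭 : 𝔭.asIdeal = maximalIdeal R := by
      refine le_antisymm (le_maximalIdeal this.ne_top) ?_
      rw [ι.annihilator_eq, Ideal.annihilator_quotient] at hk
      exact this.le_of_pow_le hk
    have e : (R ⧸ maximalIdeal R) ≃ₗ[R] N := (ι.trans (Submodule.quotEquivOfEq _ _ h𝔭)).symm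
    have : Module.Finite S (R ⧸ maximalIdeal R) := ‹Module.Finite S (ResidueField R)›
    exact Module.Finite.equiv (e.restrictScalars S)
  | exact N₁ N₂ N₃ f g hf hg hfg h₁ h₃ =>
    intro _ _ hk
    let : Module S N₁ := Module.compHom N₁ (algebraMap S R)
    let : Module S N₃ := Module.compHom N₃ (algebraMap S R)
    have : IsScalarTower S R N₁ := .of_algebraMap_smul fun _ _ => rfl
    have : IsScalarTower S R N₃ := .of_algebraMap_smul fun _ _ => rfl
    have := h₁ (hk.trans (f.annihilator_le_of_injective hf))
    have := h₃ (hk.trans (g.annihilator_le_of_surjective hg))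
    exact Module.Finite.of_exact (f := f.restrictScalars S) (g := g.restrictScalars S) hfg hg

/-- If `Q / 𝔪_S Q` has finite length, then so has `R / (Ann Q + 𝔪_S R)`, since the two have the same
support. The Weierstrass property then applies to `R / Ann Q`. -/
theorem IsWeierstrassAlgebra.finite_of_pow_maximalIdeal_le_annihilator [IsLocalRing S]
    (hR : IsWeierstrassAlgebra S R) (Q : Type u) [AddCommGroup Q] [Module R Q] [Module.Finite R Q]
    {k : ℕ}
    (hk : maximalIdeal R ^ k ≤ Module.annihilator R (Q ⧸ (maxExt S R • ⊤ : Submodule R Q))) :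
    Module.Finite S (RestrictScalars S R Q) := by
  let : Module S Q := Module.compHom Q (algebraMap S R)
  have : IsScalarTower S R Q := .of_algebraMap_smul fun _ _ => rfl
  have := hR.finite_residueField
  have hrad : maximalIdeal R ≤ (Module.annihilator R Q ⊔ maxExt S R).radical := by
    rw [Ideal.radical_eq_sInf]
    refine le_sInf fun 𝔭 ⟨h𝔭, h𝔭p⟩ => h𝔭p.le_of_pow_le (hk.trans ?_)
    have h1 : (⟨𝔭, h𝔭p⟩ : PrimeSpectrum R) ∈
        Module.support R Q ∩ PrimeSpectrum.zeroLocus (maxExt S R) := by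
      rw [Module.support_eq_zeroLocus]
      exact ⟨le_sup_left.trans h𝔭, le_sup_right.trans h𝔭⟩
    rw [← Module.support_quotient, Module.support_eq_zeroLocus] at h1
    exact h1
  obtain ⟨l, hl⟩ := Ideal.exists_pow_le_of_le_radical_of_fg hrad
    (maximalIdeal R).fg_of_isNoetherianRing
  have hfin := hR.finite_quotient (Module.annihilator R Q)
    (Module.finite_of_pow_maximalIdeal_le_annihilator (k := l) _
      (by rwa [Ideal.annihilator_quotient]))
  let : Module (R ⧸ Module.annihilator R Q) Q := Module.quotientAnnihilator
  have h2 : IsScalarTower R (R ⧸ Module.annihilator R Q) Q := .of_algebraMap_smul fun _ _ => rfl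
  have h3 : IsScalarTower S (R ⧸ Module.annihilator R Q) Q := .of_algebraMap_smul fun s x => by
    rw [IsScalarTower.algebraMap_apply S R (R ⧸ Module.annihilator R Q), algebraMap_smul,
      algebraMap_smul]
  have := Module.Finite.of_restrictScalars_finite R (R ⧸ Module.annihilator R Q) Q
  have : Module.Finite S Q := Module.Finite.trans (R ⧸ Module.annihilator R Q) Q
  exact .equiv (RestrictScalars.equivOfIsScalarTower Q).symm

theorem exists_pow_maximalIdeal_mul_saturation_le {A : Type u} [CommRing A] [IsLocalRing A]
    [IsNoetherianRing A] (J : Ideal A) :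
    ∃ k : ℕ, ∀ a ∈ maximalIdeal A ^ k, ∀ x ∈ saturation J, a * x ∈ J := by
  let c : ℕ →o Ideal A := ⟨fun k => J.colon ((maximalIdeal A ^ k : Ideal A) : Set A),
    fun k l hkl x hx => by
      rw [Submodule.mem_colon] at hx ⊢
      exact fun a ha => hx a (Ideal.pow_le_pow_right hkl ha)⟩
  refine ⟨monotonicSequenceLimitIndex c, fun a ha x hx => ?_⟩
  have h1 : x ∈ ⨆ k, c k := hx
  rw [WellFoundedGT.iSup_eq_monotonicSequenceLimit] at h1
  rw [mul_comm]
  exact Submodule.mem_colon.mp h1 a ha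

end WeierstrassAlgebra

/-! ### Flat deformation of the saturation -/

theorem seqIdeal_reduction (S : Type v) [CommRing S] [IsLocalRing S] {R : Type u} [CommRing R]
    [Algebra S R] {n : ℕ} (F : Fin n → R) :
    Ideal.map (Ideal.Quotient.mk (maxExt S R)) (seqIdeal F) = seqIdeal (reduction S F) := by
  rw [seqIdeal, seqIdeal, Ideal.map_span, ← Set.range_comp]
  rfl

theorem Ideal.ofList_ofFn {R : Type u} [CommRing R] {n : ℕ} (F : Fin n → R) :
    Ideal.ofList (List.ofFn F) = seqIdeal F := by
  refine congrArg Ideal.span (Set.ext fun r => ?_)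
  simp [List.mem_ofFn]

theorem pow_maximalIdeal_le_annihilator_saturationQuotient {R : Type u} [CommRing R]
    [IsLocalRing R] [IsNoetherianRing R] {𝔟 : Ideal R} [IsLocalRing (R ⧸ 𝔟)] (J : Ideal (R ⧸ 𝔟)) :
    ∃ k : ℕ, maximalIdeal R ^ k ≤ Module.annihilator R (SaturationQuotient J) := by
  obtain ⟨k, hk⟩ := exists_pow_maximalIdeal_mul_saturation_le J
  have := IsLocalHom.of_surjective (Ideal.Quotient.mk 𝔟) Ideal.Quotient.mk_surjective
  have hmap : Ideal.map (Ideal.Quotient.mk 𝔟) (maximalIdeal R) ≤ maximalIdeal (R ⧸ 𝔟) :=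
    ((local_hom_TFAE (Ideal.Quotient.mk 𝔟)).out 0 2).mp this
  refine ⟨k, fun a ha => Module.mem_annihilator.mpr fun z => ?_⟩
  obtain ⟨x, rfl⟩ := Submodule.Quotient.mk_surjective _ z
  refine (Submodule.Quotient.mk_eq_zero _).mpr ?_
  have h1 : Ideal.Quotient.mk 𝔟 a ∈ maximalIdeal (R ⧸ 𝔟) ^ k := by
    have h2 := Ideal.mem_map_of_mem (Ideal.Quotient.mk 𝔟) ha
    rw [Ideal.map_pow] at h2
    exact Ideal.pow_right_mono hmap k h2
  exact hk _ h1 x x.2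

theorem mainTheorem3
    {S : Type v} [CommRing S] [IsLocalRing S] [IsNoetherianRing S]
    {R : Type u} [CommRing R] [IsLocalRing R] [IsNoetherianRing R]
    [Algebra S R] [Module.Flat S R]
    (n : ℕ) [IsRegularLocalRing (SpecialFibre S R)]
    (hdim : ringKrullDim (SpecialFibre S R) = n)
    (F : Fin n → R) (hF : IsRelativeAlmostCompleteIntersection S F) :
    Module.Flat S (RestrictScalars S R (ExtToRing R (H0 F) n)) ∧
    (IsWeierstrassAlgebra S R →
      Module.Free S (RestrictScalars S R (ExtToRing R (H0 F) n)) ∧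
      Module.Finite S (RestrictScalars S R (ExtToRing R (H0 F) n))) ∧
    (∀ k : ℕ, n + 1 ≤ k → Subsingleton (ExtToRing R (H0 F) k)) ∧
    Nonempty
      ((ExtToRing R (H0 F) n ⧸ (maxExt S R • ⊤ : Submodule R (ExtToRing R (H0 F) n))) ≃ₗ[R]
        SaturationQuotient (seqIdeal (reduction S F))) := by
  have hACI : (seqIdeal (reduction S F)).height + 1 = n := hF.reduction_isACI
  have hflat : Module.Flat S (R ⧸ seqIdeal F) := hF.flat_H0
  obtain ⟨d, rfl⟩ : ∃ d, n = d + 1 := by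
    refine Nat.exists_eq_succ_of_ne_zero ?_
    -- The height of `J` plus one is not zero.
    rintro rfl
    simp at hACI
  have hloc : maxExt S R ≤ maximalIdeal R :=
    le_maximalIdeal (Ideal.Quotient.nontrivial_iff.mp inferInstance)
  have hJm : seqIdeal (reduction S F) ≤ maximalIdeal (SpecialFibre S R) := by
    refine le_maximalIdeal fun htop => ?_
    rw [htop, Ideal.height_top, top_add] at hACI
    exact ENat.top_ne_natCast _ hACI
  obtain ⟨rs, h, hlen, h𝔧, hreg⟩ := IsRegularLocalRing.exists_isWeaklyRegular_map_of_le_height hdim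
    (φ := Ideal.Quotient.mk (maxExt S R)) Ideal.Quotient.mk_surjective (List.ofFn F)
    List.length_ofFn (by rw [Ideal.ofList_ofFn, seqIdeal_reduction, hACI])
  rw [Ideal.ofList_ofFn] at h𝔧
  have hrs : RingTheory.Sequence.IsWeaklyRegular (SpecialFibre S R) rs :=
    (RingTheory.Sequence.isWeaklyRegular_map_algebraMap_iff (SpecialFibre S R) (SpecialFibre S R)
      rs).mp hreg
  have hpd : HasProjectiveDimensionLE (ModuleCat.of R (R ⧸ seqIdeal F)) (d + 1) :=
    hasProjectiveDimensionLE_of_flat (S := S) hloc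
      (IsRegularLocalRing.hasProjectiveDimensionLE (d + 1) _ hdim _)
  -- By Rees' isomorphism and the long exact sequence, `Extᵈ⁺¹(R / J, 𝔞R) → Extᵈ⁺¹(R / J, R)` is
  -- injective for every ideal `𝔞` of `S`.
  have hQflat : Module.Flat S (RestrictScalars S R (ExtToRing R (H0 F) (d + 1))) :=
    ModuleCat.flat_ext_of_injective _ _ fun 𝔞 => ModuleCat.extMap_subtype_injective _ _
      (hlen ▸ ModuleCat.extMap_mkQ_surjective_of_flat hloc hrs h𝔧 𝔞)
  obtain ⟨e⟩ := IsRegularLocalRing.nonempty_ext_specialFibre_equiv hloc hdim hlen hrs h𝔧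
    (seqIdeal_reduction S F) hJm
  -- Right exactness of `Extᵈ⁺¹(R / J, -)` identifies the reduction of `Extᵈ⁺¹(R / J, R)` with
  -- `Extᵈ⁺¹(R / J, P)`.
  let e' : (ExtToRing R (H0 F) (d + 1) ⧸
      (maxExt S R • ⊤ : Submodule R (ExtToRing R (H0 F) (d + 1)))) ≃ₗ[R]
      SaturationQuotient (seqIdeal (reduction S F)) :=
    (Submodule.quotEquivOfEq _ _ (ModuleCat.ker_extMap_mkQ (ModuleCat.of R (R ⧸ seqIdeal F)) (d + 1)
      (maxExt S R).fg_of_isNoetherianRing).symm ≪≫ₗ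
      LinearMap.quotKerEquivOfSurjective _ (ModuleCat.extMap_surjective _ _
        (Submodule.mkQ_surjective (maxExt S R)))) ≪≫ₗ e
  refine ⟨hQflat, fun hR => ?_, fun k hk => ?_, ⟨e'⟩⟩
  · obtain ⟨k, hk⟩ := pow_maximalIdeal_le_annihilator_saturationQuotient
      (seqIdeal (reduction S F))
    have : Module.Finite R (ExtToRing R (H0 F) (d + 1)) := ModuleCat.finite_ext R _ _ _
    have := hR.finite_of_pow_maximalIdeal_le_annihilator (ExtToRing R (H0 F) (d + 1)) (k := k)
      (by rwa [e'.annihilator_eq])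
    exact ⟨Module.Flat.free_restrictScalars (ExtToRing R (H0 F) (d + 1)), this⟩
  · have : HasProjectiveDimensionLT (ModuleCat.of R (R ⧸ seqIdeal F)) (d + 1 + 1) := hpd
    exact HasProjectiveDimensionLT.subsingleton _ (d + 1 + 1) k hk _
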